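/- Let $k$ be an even integer with $k\ge 2$. For an even integer $w$ and $z=x+iy$ in the upper half-plane $\mathbb H$, put $$E_w(z,s)=\frac12\sum_{(m,n)\in\mathbb Z^2\setminus\{(0,0)\}}\frac{y^s}{(mz+n)^{w}\,|mz+n|^{2s}}\qquad(\Re s>1-\tfrac w2),$$ and let $$\widehat{\widehat E}_w(z,s)=\Big(s+\frac w2\Big)\Big(s+\frac w2-1\Big)\,\pi^{-(s+w/2)}\,\Gamma\Big(s+\frac w2+\frac{|w|}2\Big)E_w(z,s),$$ continued analytically in $s$. Let $\xi_w f=2i\,y^{w}\,\overline{\partial f/\partial\bar z}$ with $\frac{\partial}{\partial\bar z}=\frac12\big(\frac{\partial}{\partial x}+i\frac{\partial}{\partial y}\big)$, and let $\Delta_w=y^2\big(\frac{\partial^2}{\partial x^2}+\frac{\partial^2}{\partial y^2}\big)-iwy\big(\frac{\partial}{\partial x}+i\frac{\partial}{\partial y}\big)$. For $w=k$ and $w=2-k$ and every $z\in\mathbb H$, the function $\widehat{\widehat E}_w(z,s)$ extends to an entire function of $s$. Write its Taylor expansions at $s=0$ as $$\widehat{\widehat E}_k(z,s)=\sum_{n\ge0}G_{n,k}(z)s^n,\qquad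 \widehat{\widehat E}_{2-k}(z,s)=\sum_{n\ge0}F_{n,2-k}(z)s^n .$$ Let $c_{n,k,\ell}$ ($n\ge0$, $1\le\ell\le n+1$) be complex constants and set $c_{n,k,0}=1$, $c_{n,k,-1}=0$. Define for $n\ge 0$ $$\widetilde G_{n,k}=G_{n,k}+\sum_{\ell=1}^n(-1)^\ell c_{n,k,\ell}\,G_{n-\ell,k},\qquad \widetilde F_{n,2-k}=(-1)^n\Big(F_{n,2-k}+\sum_{\ell=1}^n\overline{c_{n,k,\ell}}\,F_{n-\ell,2-k}\Big).$$ Suppose that the connection equations $$c_{n,k,\ell}=\frac1{k-1}\,c_{n,k,\ell-1}+c_{n-1,k,\ell}\qquad(n\ge1,\ 0\le\ell\le n)$$ hold. Then all $\widetilde G_{n,k}$ and $\widetilde F_{n,2-k}$ are $C^\infty$ functions of $(x,y)$ on $\mathbb H$, and for every $n\ge1$: 1. (ramp relations) $\xi_k\widetilde G_{n,k}=(k-1)\,\widetilde F_{n-1,2-k}$ and $\xi_{2-k}\widetilde F_{n,2-k}=\widetilde G_{n,k}$; 2. (tower relations) $\Delta_k\widetilde G_{n,k}=(k-1)\,\widetilde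 G_{n-1,k}$ and $\Delta_{2-k}\widetilde F_{n,2-k}=(k-1)\,\widetilde F_{n-1,2-k}$. Moreover the constants $c_{n,k,n+1}$ ($n\ge0$) are free: for every complex sequence $(d_n)_{n\ge0}$ the connection equations have a solution with $c_{n,k,n+1}=d_n$ for all $n\ge0$. -/

import Mathlib

open scoped UpperHalfPlane ContDiff ComplexConjugate

noncomputable section

namespace PolyMaass

/-- The non-holomorphic Eisenstein series
`E_k(z,s) = (1/2) ∑_{(m,n) ≠ (0,0)} y^s / ((m z + n)^k |m z + n|^{2 s})`,
absolutely convergent for `Re s > 1 - k / 2`. -/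
def eisSeries (k : ℤ) (z : ℍ) (s : ℂ) : ℂ :=
  (1 / 2 : ℂ) * ∑' p : {p : ℤ × ℤ // p ≠ (0, 0)},
    ((z.im : ℝ) : ℂ) ^ s /
      (((p.1.1 : ℂ) * (z : ℂ) + (p.1.2 : ℂ)) ^ k *
        ((‖(p.1.1 : ℂ) * (z : ℂ) + (p.1.2 : ℂ)‖ : ℝ) : ℂ) ^ (2 * s))

/-- The completed series `π^{-(s + k/2)} Γ(s + k/2 + |k|/2) E_k(z,s)`, as given by the series. -/
def completedSeries (k : ℤ) (z : ℍ) (s : ℂ) : ℂ :=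
  (Real.pi : ℂ) ^ (-(s + (k : ℂ) / 2)) *
    Complex.Gamma (s + (k : ℂ) / 2 + ((|k| : ℤ) : ℂ) / 2) * eisSeries k z s

/-- The doubly completed series `(s + k/2) (s + k/2 - 1)` times the completed one,
as given by the series. -/
def doublyCompletedSeries (k : ℤ) (z : ℍ) (s : ℂ) : ℂ :=
  (s + (k : ℂ) / 2) * (s + (k : ℂ) / 2 - 1) * completedSeries k z s

/-- `g` is an entire function that agrees with the doubly completed Eisenstein series of weight
`k` at `z` in the half-plane of absolute convergence. By the identity theorem there is at most one
such `g`. -/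
def IsEntireContinuation (k : ℤ) (z : ℍ) (g : ℂ → ℂ) : Prop :=
  Differentiable ℂ g ∧ ∀ s : ℂ, 1 - (k : ℝ) / 2 < s.re → g s = doublyCompletedSeries k z s

open Classical in
/-- The doubly completed Eisenstein series as an entire function of `s`: the analytic continuation
of `doublyCompletedSeries k z`. -/
def doublyCompletedEis (k : ℤ) (z : ℍ) : ℂ → ℂ :=
  if h : ∃ g : ℂ → ℂ, IsEntireContinuation k z g then h.choose else 0

/-- The `n`-th Taylor coefficient at `s = 0` of the doubly completed Eisenstein series of
weight `k`. -/
def taylorCoeff (k : ℤ) (n : ℕ) (z : ℍ) : ℂ :=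
  iteratedDeriv n (doublyCompletedEis k z) 0 / (n.factorial : ℂ)

/-- `G_{n,k}` (used for weights `k ≥ 2`). -/
def G (n : ℕ) (k : ℤ) : ℍ → ℂ := taylorCoeff k n

/-- `F_{n,k}` (used for weights `k ≤ 0`). -/
def F (n : ℕ) (k : ℤ) : ℍ → ℂ := taylorCoeff k n

/-- `∂f/∂x` for a function on the upper half-plane. -/
def partialX (f : ℍ → ℂ) (z : ℍ) : ℂ :=
  lineDeriv ℝ (fun w : ℂ => f (UpperHalfPlane.ofComplex w)) (z : ℂ) 1

/-- `∂f/∂y` for a function on the upper half-plane. -/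
def partialY (f : ℍ → ℂ) (z : ℍ) : ℂ :=
  lineDeriv ℝ (fun w : ℂ => f (UpperHalfPlane.ofComplex w)) (z : ℂ) Complex.I

/-- The Wirtinger derivative `∂f/∂z̄ = (1/2) (∂f/∂x + i ∂f/∂y)`. -/
def dbar (f : ℍ → ℂ) (z : ℍ) : ℂ :=
  (1 / 2 : ℂ) * (partialX f z + Complex.I * partialY f z)

/-- `ξ_k f = 2 i y^k` times the complex conjugate of `∂f/∂z̄`. -/
def xi (k : ℤ) (f : ℍ → ℂ) (z : ℍ) : ℂ :=
  2 * Complex.I * ((z.im : ℝ) : ℂ) ^ k * conj (dbar f z)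

/-- The weight `k` hyperbolic Laplacian
`Δ_k = y² (∂²/∂x² + ∂²/∂y²) - i k y (∂/∂x + i ∂/∂y)`. -/
def hypLaplacian (k : ℤ) (f : ℍ → ℂ) (z : ℍ) : ℂ :=
  ((z.im : ℝ) : ℂ) ^ 2 * (partialX (partialX f) z + partialY (partialY f) z)
    - Complex.I * (k : ℂ) * ((z.im : ℝ) : ℂ) * (partialX f z + Complex.I * partialY f z)

/-- `f` is a `C^∞` function of the two real variables `x, y` on the upper half-plane. -/
def IsSmooth (f : ℍ → ℂ) : Prop :=
  ContDiffOn ℝ ∞ (fun w : ℂ => f (UpperHalfPlane.ofComplex w)) {w : ℂ | 0 < w.im}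

/-- The connection equations for the constants `c n ℓ = c_{n,k,ℓ}`, with the conventions
`c_{n,k,0} = 1` and `c_{n,k,-1} = 0`. Only the values with `-1 ≤ ℓ ≤ n + 1` matter. -/
structure ConnectionEquations (k : ℤ) (c : ℕ → ℤ → ℂ) : Prop where
  zero : ∀ n : ℕ, c n 0 = 1
  neg_one : ∀ n : ℕ, c n (-1) = 0
  rec_eq : ∀ n : ℕ, 1 ≤ n → ∀ l : ℤ, 0 ≤ l → l ≤ n →
    c n l = 1 / ((k : ℂ) - 1) * c n (l - 1) + c (n - 1) l

/-- The modified function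
`G̃_{n,k} = G_{n,k} + ∑_{ℓ=1}^n (-1)^ℓ c_{n,k,ℓ} G_{n-ℓ,k}`. -/
def modG (k : ℤ) (c : ℕ → ℤ → ℂ) (n : ℕ) (z : ℍ) : ℂ :=
  G n k z + ∑ l ∈ Finset.Icc 1 n, (-1 : ℂ) ^ l * c n (l : ℤ) * G (n - l) k z

/-- The modified function `F̃_{n,2-k}`, which is `(-1)^n` times
`F_{n,2-k} + ∑_{ℓ=1}^n conj(c_{n,k,ℓ}) F_{n-ℓ,2-k}`; here `k` is the dual weight. -/
def modF (k : ℤ) (c : ℕ → ℤ → ℂ) (n : ℕ) (z : ℍ) : ℂ :=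
  (-1 : ℂ) ^ n *
    (F n (2 - k) z + ∑ l ∈ Finset.Icc 1 n, conj (c n (l : ℤ)) * F (n - l) (2 - k) z)

end PolyMaass

end

/-!
Summing the Gaussians `exp (-π t |m z + n|² / y)` with a spherical polynomial factor gives a theta
series, whose functional equation under `t ↦ 1 / t` is Poisson summation. Splitting the Mellin
transform at `t = 1` writes the completed Eisenstein series, up to an elementary polynomial, as a
lattice sum of a rapidly decaying function of `|m z + n|² / y`; this is entire in `s` and smooth in
`z`, and can be differentiated term by term. Doing so shows that `ξ` carries the completed series of
weight `2 - k` at `s` to that of weight `k` at `- s̄`, and back again up to the factor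
`s (s + k - 1)`. The Taylor coefficients at `s = 0` are Cauchy integrals over the unit circle and
hence inherit the smoothness and the `ξ`-relations. Because of the factor `s (s + k - 1)`, each
`ξ G_n` combines `F_{n - 1}` and `F_{n - 2}`, and the connection equations say exactly that the
modified sums absorb the second term. The tower relations follow from
`Δ_w = ξ_{2 - w} ξ_w`.
-/

noncomputable section

namespace PolyMaass

open Filter Topology MeasureTheory Set Asymptotics

section Wirtinger

variable {B : Type*} [NormedAddCommGroup B] [NormedSpace ℂ B]

/-- The real-linear map `h ↦ h • v.1 + conj h • v.2`, as a continuous function of `v`. The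
derivative of `f` at `z` is of this form with `v = (∂f/∂z, ∂f/∂z̄)`. -/
def wirtingerL (B : Type*) [NormedAddCommGroup B] [NormedSpace ℂ B] : B × B →L[ℝ] ℂ →L[ℝ] B :=
  (ContinuousLinearMap.lsmul ℝ ℂ).flip ∘L .fst ℝ B B +
    (ContinuousLinearMap.compL ℝ ℂ ℂ B).flip Complex.conjCLE ∘L
      (ContinuousLinearMap.lsmul ℝ ℂ).flip ∘L .snd ℝ B B

lemma wirtingerL_apply (v : B × B) (h : ℂ) : wirtingerL B v h = h • v.1 + conj h • v.2 := rfl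

/-- The Wirtinger derivative `∂f/∂z̄` of a vector-valued function on `ℂ`. -/
def dbarC (f : ℂ → B) (z : ℂ) : B :=
  (1 / 2 : ℂ) • (fderiv ℝ f z 1 + Complex.I • fderiv ℝ f z Complex.I)

lemma dbarC_of_hasFDerivAt {f : ℂ → B} {v : B × B} {z : ℂ}
    (hf : HasFDerivAt f (wirtingerL B v) z) : dbarC f z = v.2 := by
  rw [dbarC, hf.fderiv, wirtingerL_apply, wirtingerL_apply, map_one, Complex.conj_I]
  match_scalars
  · linear_combination (1 / 2 : ℂ) * Complex.I_sq
  · linear_combination (-1 / 2 : ℂ) * Complex.I_sq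

lemma dbarC_congr {f g : ℂ → B} {z : ℂ} (h : f =ᶠ[𝓝 z] g) : dbarC f z = dbarC g z := by
  rw [dbarC, dbarC, h.fderiv_eq]

lemma dbarC_const (b : B) (z : ℂ) : dbarC (fun _ => b) z = 0 := by
  simp [dbarC]

lemma dbarC_clm {C : Type*} [NormedAddCommGroup C] [NormedSpace ℂ C] (T : B →L[ℂ] C)
    {f : ℂ → B} {z : ℂ} (hf : DifferentiableAt ℝ f z) :
    dbarC (fun w => T (f w)) z = T (dbarC f z) := by
  have h : HasFDerivAt (fun w => T (f w)) (T.restrictScalars ℝ ∘L fderiv ℝ f z) z :=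
    (T.restrictScalars ℝ).hasFDerivAt.comp z hf.hasFDerivAt
  simp [dbarC, h.fderiv]

lemma dbarC_const_smul {f : ℂ → B} {z : ℂ} (hf : DifferentiableAt ℝ f z) (a : ℂ) :
    dbarC (fun w => a • f w) z = a • dbarC f z :=
  dbarC_clm (a • ContinuousLinearMap.id ℂ B) hf

lemma dbarC_add {f g : ℂ → B} {z : ℂ} (hf : DifferentiableAt ℝ f z)
    (hg : DifferentiableAt ℝ g z) :
    dbarC (fun w => f w + g w) z = dbarC f z + dbarC g z := by
  rw [dbarC, fderiv_fun_add hf hg, dbarC, dbarC]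
  simp only [add_apply, smul_add]
  abel

end Wirtinger

section Lattice

/-- Nonzero pairs of integers, the index set of the Eisenstein series. -/
abbrev Pairs : Type := {p : ℤ × ℤ // p ≠ (0, 0)}

/-- The lattice point `m z + n` with coordinates `p = (m, n)`. -/
def lin (p : ℤ × ℤ) (z : ℂ) : ℂ := (p.1 : ℂ) * z + (p.2 : ℂ)

/-- The quadratic form `|m z + n|² / y` of discriminant `-4` in `p = (m, n)`. -/
def quad (p : ℤ × ℤ) (z : ℂ) : ℝ := Complex.normSq (lin p z) / z.im

lemma one_le_norm_pairs (p : Pairs) : 1 ≤ ‖(p : ℤ × ℤ)‖ := by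
  obtain ⟨⟨m, n⟩, hmn⟩ := p
  have hne : m ≠ 0 ∨ n ≠ 0 := by simpa [or_iff_not_imp_left] using hmn
  simp only [Prod.norm_def, Int.norm_eq_abs, le_max_iff]
  exact_mod_cast hne.imp Int.one_le_abs Int.one_le_abs

lemma summable_norm_pairs {N : ℝ} (hN : 2 < N) :
    Summable fun p : Pairs => ‖(p : ℤ × ℤ)‖ ^ (-N) := by
  have h : Summable fun p : ℤ × ℤ => ‖p‖ ^ (-N) := by
    rw [← (finTwoArrowEquiv ℤ).summable_iff]
    refine (EisensteinSeries.summable_one_div_norm_rpow hN).congr fun x => ?_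
    simp [EisensteinSeries.norm_eq_max_natAbs, Prod.norm_def, Int.norm_eq_abs, Nat.cast_natAbs]
  exact h.subtype _

lemma norm_lin_le (p : ℤ × ℤ) (z : ℂ) : ‖lin p z‖ ≤ (‖z‖ + 1) * ‖p‖ := by
  have hfst : ‖p.1‖ ≤ ‖p‖ := norm_fst_le p
  have hsnd : ‖p.2‖ ≤ ‖p‖ := norm_snd_le p
  calc ‖lin p z‖ ≤ ‖p.1‖ * ‖z‖ + ‖p.2‖ := by
        refine (norm_add_le _ _).trans ?_
        simp [Complex.norm_intCast, Int.norm_eq_abs]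
    _ ≤ ‖p‖ * ‖z‖ + ‖p‖ := by gcongr
    _ = (‖z‖ + 1) * ‖p‖ := by ring

lemma norm_le_lin (p : ℤ × ℤ) {z : ℂ} (hz : 0 < z.im) :
    ‖p‖ ≤ (1 / z.im + 1 + ‖z‖ / z.im) * ‖lin p z‖ := by
  have hfst : ‖p.1‖ ≤ 1 / z.im * ‖lin p z‖ := by
    have him : (lin p z).im = p.1 * z.im := by simp [lin]
    have := Complex.abs_im_le_norm (lin p z)
    rw [him, abs_mul, abs_of_pos hz] at this
    rw [Int.norm_eq_abs]
    field_simp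
    exact this
  have hsnd : ‖p.2‖ ≤ (1 + ‖z‖ / z.im) * ‖lin p z‖ := by
    calc ‖p.2‖ = ‖lin p z - p.1 * z‖ := by simp [lin, Complex.norm_intCast, Int.norm_eq_abs]
      _ ≤ ‖lin p z‖ + ‖p.1‖ * ‖z‖ := by
        refine (norm_sub_le _ _).trans ?_
        simp [Complex.norm_intCast, Int.norm_eq_abs]
      _ ≤ ‖lin p z‖ + 1 / z.im * ‖lin p z‖ * ‖z‖ := by gcongr
      _ = (1 + ‖z‖ / z.im) * ‖lin p z‖ := by ring
  rw [Prod.norm_def]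
  refine max_le (hfst.trans ?_) (hsnd.trans ?_)
  · gcongr
    rw [add_assoc]
    exact le_add_of_nonneg_right (by positivity)
  · gcongr
    exact le_add_of_nonneg_left (by positivity)

lemma lin_ne_zero (p : Pairs) {z : ℂ} (hz : 0 < z.im) : lin p z ≠ 0 := by
  intro h
  have hnorm := (one_le_norm_pairs p).trans (norm_le_lin p hz)
  rw [h, norm_zero, mul_zero] at hnorm
  exact hnorm.not_gt one_pos

lemma quad_pos (p : Pairs) {z : ℂ} (hz : 0 < z.im) : 0 < quad p z :=
  div_pos (Complex.normSq_pos.2 (lin_ne_zero p hz)) hz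

lemma mul_conj_lin (p : ℤ × ℤ) {z : ℂ} (hz : 0 < z.im) :
    lin p z * conj (lin p z) = z.im * quad p z := by
  have : (z.im : ℂ) ≠ 0 := Complex.ofReal_ne_zero.2 hz.ne'
  rw [Complex.mul_conj, quad, Complex.ofReal_div]
  field_simp

lemma eventually_im_pos {z : ℂ} (hz : 0 < z.im) : ∀ᶠ w in 𝓝 z, 0 < w.im :=
  Complex.continuous_im.continuousAt.eventually (lt_mem_nhds hz)

lemma isBigO_lin (z₀ : ℂ) :
    (fun x : ℂ × Pairs => lin x.2 x.1) =O[𝓝 z₀ ×ˢ ⊤] fun x => ‖(x.2 : ℤ × ℤ)‖ := by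
  have hbound : ∀ᶠ z in 𝓝 z₀, ‖z‖ + 1 < ‖z₀‖ + 2 :=
    (by fun_prop : ContinuousAt (fun z : ℂ => ‖z‖ + 1) z₀).eventually
      (gt_mem_nhds (by linarith))
  refine .of_bound (‖z₀‖ + 2) ((hbound.prod_inl ⊤).mono fun x hx => ?_)
  rw [norm_norm]
  exact (norm_lin_le _ _).trans (by gcongr)

lemma exists_eventually_le_quad {z₀ : ℂ} (hz₀ : 0 < z₀.im) :
    ∃ δ > 0, ∀ᶠ z in 𝓝 z₀, ∀ p : ℤ × ℤ, δ * ‖p‖ ^ 2 ≤ quad p z := by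
  set κ : ℂ → ℝ := fun z => 1 / z.im + 1 + ‖z‖ / z.im
  have hcont : ContinuousAt (fun z => κ z ^ 2 * z.im) z₀ := by
    have : z₀.im ≠ 0 := hz₀.ne'
    fun_prop (disch := assumption)
  have hpos : 0 < κ z₀ ^ 2 * z₀.im := by positivity
  refine ⟨(κ z₀ ^ 2 * z₀.im + 1)⁻¹, by positivity, ?_⟩
  filter_upwards [hcont.eventually (gt_mem_nhds (lt_add_one _)), eventually_im_pos hz₀]
    with z hlt hz p
  have hκz : 0 < κ z := by positivity
  calc (κ z₀ ^ 2 * z₀.im + 1)⁻¹ * ‖p‖ ^ 2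
      ≤ (κ z ^ 2 * z.im)⁻¹ * (κ z * ‖lin p z‖) ^ 2 := by
        gcongr
        exact norm_le_lin p hz
    _ = quad p z := by
        rw [quad, Complex.normSq_eq_norm_sq]
        field_simp

end Lattice

section LatticeSum

variable {B : Type*} [NormedAddCommGroup B]

/-- `E q = O(q ^ (-N))` on every half-line `[q₀, ∞)` with `q₀ > 0`: the condition on the radial
profile of a lattice sum that makes the sum converge locally uniformly. -/
def Decays (E : ℝ → B) (N : ℝ) : Prop :=
  ∀ q₀ > 0, E =O[𝓟 (Ici q₀)] fun q => q ^ (-N)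

/-- Decay faster than every power of `q`, on every half-line `[q₀, ∞)` with `q₀ > 0`. -/
def RapidDecay (E : ℝ → B) : Prop := ∀ N, Decays E N

lemma Decays.isBigO_quad {E : ℝ → B} {N : ℝ} (hE : Decays E N) (hN : 0 ≤ N) {z₀ : ℂ}
    (hz₀ : 0 < z₀.im) : (fun x : ℂ × Pairs => E (quad x.2 x.1)) =O[𝓝 z₀ ×ˢ ⊤]
      fun x => ‖(x.2 : ℤ × ℤ)‖ ^ (-(2 * N)) := by
  obtain ⟨δ, hδ, hquad⟩ := exists_eventually_le_quad hz₀
  have hlower : ∀ᶠ x : ℂ × Pairs in 𝓝 z₀ ×ˢ ⊤, δ * ‖(x.2 : ℤ × ℤ)‖ ^ 2 ≤ quad x.2 x.1 :=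
    (hquad.prod_inl ⊤).mono fun x hx => hx x.2
  have htendsto : Tendsto (fun x : ℂ × Pairs => quad x.2 x.1) (𝓝 z₀ ×ˢ ⊤) (𝓟 (Ici δ)) :=
    tendsto_principal.2 <| hlower.mono fun x hx =>
      (le_mul_of_one_le_right hδ.le (one_le_pow₀ (one_le_norm_pairs x.2))).trans hx
  refine ((hE δ hδ).comp_tendsto htendsto).trans (.of_bound (δ ^ (-N)) ?_)
  filter_upwards [hlower] with x hx
  have hp : 0 < ‖(x.2 : ℤ × ℤ)‖ := one_pos.trans_le (one_le_norm_pairs x.2)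
  have hq : 0 < quad x.2 x.1 := (by positivity : 0 < δ * ‖(x.2 : ℤ × ℤ)‖ ^ 2).trans_le hx
  rw [Function.comp_apply, Real.norm_of_nonneg (by positivity),
    Real.norm_of_nonneg (by positivity)]
  calc quad x.2 x.1 ^ (-N) ≤ (δ * ‖(x.2 : ℤ × ℤ)‖ ^ 2) ^ (-N) :=
        Real.rpow_le_rpow_of_nonpos (by positivity) hx (by linarith)
    _ = δ ^ (-N) * ‖(x.2 : ℤ × ℤ)‖ ^ (-(2 * N)) := by
        rw [Real.mul_rpow hδ.le (by positivity), ← Real.rpow_natCast, ← Real.rpow_mul hp.le,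
          Nat.cast_ofNat, mul_neg]

variable [NormedSpace ℂ B]

/-- The summand `u ^ b * conj u ^ c • E (|u|² / y)`, `u = m z + n`, of a lattice sum with radial
profile `E`. -/
def latTerm (b c : ℕ) (E : ℝ → B) (z : ℂ) (p : ℤ × ℤ) : B :=
  (lin p z ^ b * conj (lin p z) ^ c) • E (quad p z)

/-- The sum of `u ^ b * conj u ^ c • E (|u|² / y)` over the nonzero lattice points `u = m z + n`.
The Eisenstein series, the theta series and their incomplete Mellin transforms are all of this
form. -/
def latSum (b c : ℕ) (E : ℝ → B) (z : ℂ) : B := ∑' p : Pairs, latTerm b c E z p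

lemma isBigO_latTerm {E : ℝ → B} {N M : ℝ} (hE : Decays E N) (hN : 0 ≤ N) {b c : ℕ}
    (hM : M + (b + c : ℕ) ≤ 2 * N) {z₀ : ℂ} (hz₀ : 0 < z₀.im) :
    (fun x : ℂ × Pairs => latTerm b c E x.1 x.2) =O[𝓝 z₀ ×ˢ ⊤]
      fun x => ‖(x.2 : ℤ × ℤ)‖ ^ (-M) := by
  have hlin := isBigO_lin z₀
  have hconj : (fun x : ℂ × Pairs => conj (lin x.2 x.1)) =O[𝓝 z₀ ×ˢ ⊤]
      fun x => ‖(x.2 : ℤ × ℤ)‖ :=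
    .of_norm_left (hlin.norm_left.congr_left fun x => (RCLike.norm_conj (lin x.2 x.1)).symm)
  refine (((hlin.pow b).mul (hconj.pow c)).smul (hE.isBigO_quad hN hz₀)).trans (.of_norm_le ?_)
  intro x
  have hp := one_le_norm_pairs x.2
  have hp' : 0 < ‖(x.2 : ℤ × ℤ)‖ := one_pos.trans_le hp
  rw [smul_eq_mul, ← pow_add, ← Real.rpow_natCast, ← Real.rpow_add hp',
    Real.norm_of_nonneg (by positivity)]
  exact Real.rpow_le_rpow_of_exponent_le hp (by linarith)

lemma summable_latTerm {E : ℝ → B} {N : ℝ} (hE : Decays E N) {b c : ℕ}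
    (hN : 2 + (b + c : ℕ) < 2 * N) {z : ℂ} (hz : 0 < z.im) :
    Summable fun p : Pairs => ‖latTerm b c E z p‖ := by
  have hN0 : 0 ≤ N := by linarith [(b + c : ℕ).cast_nonneg (α := ℝ)]
  have hbig := isBigO_latTerm hE hN0 (M := 2 * N - (b + c : ℕ)) (sub_add_cancel _ _).le hz
  have hmk : Tendsto (fun p : Pairs => (z, p)) cofinite (𝓝 z ×ˢ ⊤) :=
    tendsto_const_nhds.prodMk tendsto_top
  exact summable_of_isBigO (summable_norm_pairs (by linarith)) (hbig.comp_tendsto hmk).norm_left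

lemma RapidDecay.isBigO_latTerm {E : ℝ → B} (hE : RapidDecay E) (b c : ℕ) (M : ℝ) {z₀ : ℂ}
    (hz₀ : 0 < z₀.im) : (fun x : ℂ × Pairs => latTerm b c E x.1 x.2) =O[𝓝 z₀ ×ˢ ⊤]
      fun x => ‖(x.2 : ℤ × ℤ)‖ ^ (-M) :=
  PolyMaass.isBigO_latTerm (hE (|M| + (b + c : ℕ))) (by positivity)
    (by linarith [le_abs_self M, abs_nonneg M, (b + c : ℕ).cast_nonneg (α := ℝ)]) hz₀

lemma RapidDecay.summable_latTerm {E : ℝ → B} (hE : RapidDecay E) (b c : ℕ) {z : ℂ}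
    (hz : 0 < z.im) : Summable fun p : Pairs => ‖latTerm b c E z p‖ :=
  PolyMaass.summable_latTerm (hE (2 + (b + c : ℕ)))
    (by linarith [(b + c : ℕ).cast_nonneg (α := ℝ)]) hz

lemma RapidDecay.hasSum_latTerm [CompleteSpace B] {E : ℝ → B} (hE : RapidDecay E) (b c : ℕ)
    {z : ℂ} (hz : 0 < z.im) : HasSum (fun p : Pairs => latTerm b c E z p) (latSum b c E z) :=
  (hE.summable_latTerm b c hz).of_norm.hasSum

end LatticeSum

section TermwiseDerivative

lemma hasFDerivAt_tsum_of_isBigO {ι E F : Type*} [NormedAddCommGroup E] [NormedSpace ℝ E]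
    [NormedAddCommGroup F] [NormedSpace ℝ F] [CompleteSpace F] {f : ι → E → F}
    {f' : ι → E → E →L[ℝ] F} {u : ι → ℝ} {x₀ : E} (hu : Summable u)
    (hbound : (fun x : E × ι => f' x.2 x.1) =O[𝓝 x₀ ×ˢ ⊤] fun x => u x.2)
    (hf : ∀ᶠ x in 𝓝 x₀, ∀ i, HasFDerivAt (f i) (f' i x) x) (hsum : Summable fun i => f i x₀) :
    HasFDerivAt (fun x => ∑' i, f i x) (∑' i, f' i x₀) x₀ := by
  obtain ⟨C, hC⟩ := hbound.bound
  have hC : ∀ᶠ x in 𝓝 x₀, ∀ i, ‖f' i x‖ ≤ C * ‖u i‖ := mem_prod_top.1 hC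
  obtain ⟨r, hr, hball⟩ := Metric.eventually_nhds_iff_ball.1 (hC.and hf)
  have hx₀ : x₀ ∈ Metric.ball x₀ r := Metric.mem_ball_self hr
  exact hasFDerivAt_tsum_of_isPreconnected (hu.norm.mul_left C) Metric.isOpen_ball
    (convex_ball x₀ r).isPreconnected (fun i x hx => (hball x hx).2 i)
    (fun i x hx => (hball x hx).1 i) hx₀ hsum hx₀

lemma isBigO_smul_of_continuousAt {ι X B : Type*} [TopologicalSpace X] [NormedAddCommGroup B]
    [NormedSpace ℂ B] {φ : X → ℂ} {x₀ : X} (hφ : ContinuousAt φ x₀) {f : X × ι → B}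
    {g : X × ι → ℝ} (hf : f =O[𝓝 x₀ ×ˢ ⊤] g) : (fun x => φ x.1 • f x) =O[𝓝 x₀ ×ˢ ⊤] g := by
  have hφ1 : (fun x : X × ι => φ x.1) =O[𝓝 x₀ ×ˢ ⊤] fun _ => (1 : ℝ) :=
    (hφ.isBigO_one ℝ).comp_tendsto tendsto_fst
  simpa only [one_smul] using hφ1.smul hf

end TermwiseDerivative

section LatticeSumDeriv

variable {B : Type*} [NormedAddCommGroup B] [NormedSpace ℂ B]

/-- The pair `(∂/∂z, ∂/∂z̄)` of derivatives of a lattice sum with radial profile `E`, where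
`E'` is the derivative of `E`. Here `T b c E` is either a single summand or the whole sum, and `y`
is the imaginary part of `z`. For `b = 0` or `c = 0` the truncated exponent `b - 1` or `c - 1`
only occurs with coefficient `0`. -/
def latDeriv (T : ℕ → ℕ → (ℝ → B) → B) (b c : ℕ) (E E' : ℝ → B) (y : ℝ) : B × B :=
  (((b : ℂ) / (2 * Complex.I * y)) • (T b c E - T (b - 1) (c + 1) E) +
      (Complex.I / (2 * (y : ℂ) ^ 2)) • T b (c + 2) E',
    ((c : ℂ) / (2 * Complex.I * y)) • (T (b + 1) (c - 1) E - T b c E) -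
      (Complex.I / (2 * (y : ℂ) ^ 2)) • T (b + 2) c E')

lemma hasFDerivAt_lin (p : ℤ × ℤ) (z : ℂ) :
    HasFDerivAt (lin p) (wirtingerL ℂ ((p.1 : ℂ), 0)) z := by
  have h : HasDerivAt (lin p) ((p.1 : ℂ) * 1) z :=
    ((hasDerivAt_id z).const_mul (p.1 : ℂ)).add_const _
  refine (h.hasFDerivAt.restrictScalars ℝ).congr_fderiv ?_
  ext h
  simp [wirtingerL_apply]

lemma hasFDerivAt_conj_lin (p : ℤ × ℤ) (z : ℂ) :
    HasFDerivAt (fun z => conj (lin p z)) (wirtingerL ℂ (0, (p.1 : ℂ))) z := by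
  refine ((Complex.conjCLE : ℂ →L[ℝ] ℂ).hasFDerivAt.comp z (hasFDerivAt_lin p z)).congr_fderiv ?_
  ext h
  simp [wirtingerL_apply]

lemma self_sub_conj (z : ℂ) : z - conj z = 2 * Complex.I * z.im := by
  rw [Complex.sub_conj, Complex.ofReal_mul, Complex.ofReal_ofNat, mul_right_comm]

lemma lin_sub_conj (p : ℤ × ℤ) (z : ℂ) :
    lin p z - conj (lin p z) = 2 * Complex.I * z.im * p.1 := by
  simp only [lin, map_add, map_mul, map_intCast]
  linear_combination (p.1 : ℂ) * self_sub_conj z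

lemma fst_eq_lin_sub_conj_div (p : ℤ × ℤ) {z : ℂ} (hz : 0 < z.im) :
    (p.1 : ℂ) = (lin p z - conj (lin p z)) / (2 * Complex.I * z.im) := by
  have : (z.im : ℂ) ≠ 0 := Complex.ofReal_ne_zero.2 hz.ne'
  rw [lin_sub_conj]
  field_simp

lemma hasFDerivAt_im (z : ℂ) :
    HasFDerivAt (fun z : ℂ => (z.im : ℂ)) (wirtingerL ℂ (-Complex.I / 2, Complex.I / 2)) z := by
  refine (Complex.ofRealCLM.comp Complex.imCLM).hasFDerivAt.congr_fderiv ?_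
  ext h
  simp only [wirtingerL_apply, smul_eq_mul, ContinuousLinearMap.comp_apply,
    Complex.imCLM_apply, Complex.ofRealCLM_apply]
  linear_combination (Complex.I / 2) * self_sub_conj h + (h.im : ℂ) * Complex.I_sq

lemma hasFDerivAt_ofReal_quad (p : ℤ × ℤ) {z : ℂ} (hz : 0 < z.im) :
    HasFDerivAt (fun z => (quad p z : ℂ))
      (wirtingerL ℂ (Complex.I / (2 * (z.im : ℂ) ^ 2) * conj (lin p z) ^ 2,
        -(Complex.I / (2 * (z.im : ℂ) ^ 2)) * lin p z ^ 2)) z := by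
  have hy : (z.im : ℂ) ≠ 0 := Complex.ofReal_ne_zero.2 hz.ne'
  have hquad : (fun z : ℂ => (quad p z : ℂ)) =
      (lin p * fun z => conj (lin p z)) * (Inv.inv ∘ fun z : ℂ => (z.im : ℂ)) := by
    ext w
    simp [quad, Complex.mul_conj, div_eq_mul_inv]
  rw [hquad]
  refine (((hasFDerivAt_lin p z).mul (hasFDerivAt_conj_lin p z)).mul
    ((hasDerivAt_inv hy).comp_hasFDerivAt z (hasFDerivAt_im z))).congr_fderiv ?_
  ext h
  simp only [wirtingerL_apply, smul_eq_mul, add_apply, smul_apply, Pi.mul_apply,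
    Function.comp_apply, fst_eq_lin_sub_conj_div p hz]
  field_simp
  ring_nf
  simp only [Complex.I_sq]
  ring

lemma hasFDerivAt_quad (p : ℤ × ℤ) {z : ℂ} (hz : 0 < z.im) :
    ∃ D : ℂ →L[ℝ] ℝ, HasFDerivAt (quad p) D z ∧ ∀ h, (D h : ℂ) =
      wirtingerL ℂ (Complex.I / (2 * (z.im : ℂ) ^ 2) * conj (lin p z) ^ 2,
        -(Complex.I / (2 * (z.im : ℂ) ^ 2)) * lin p z ^ 2) h := by
  refine ⟨_, Complex.reCLM.hasFDerivAt.comp z (hasFDerivAt_ofReal_quad p hz), fun h => ?_⟩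
  rw [ContinuousLinearMap.comp_apply, Complex.reCLM_apply, ← Complex.conj_eq_iff_re]
  simp only [wirtingerL_apply, smul_eq_mul, map_add, map_mul, map_neg, map_div₀, Complex.conj_I,
    map_pow, Complex.conj_conj, Complex.conj_ofReal, map_ofNat]
  ring

lemma hasFDerivAt_latTerm (p : ℤ × ℤ) (b c : ℕ) {E E' : ℝ → B} {z : ℂ} (hz : 0 < z.im)
    (hE : HasDerivAt E (E' (quad p z)) (quad p z)) :
    HasFDerivAt (fun z => latTerm b c E z p)
      (wirtingerL B (latDeriv (fun b c E => latTerm b c E z p) b c E E' z.im)) z := by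
  have hy : (z.im : ℂ) ≠ 0 := Complex.ofReal_ne_zero.2 hz.ne'
  obtain ⟨D, hD, hD_apply⟩ := hasFDerivAt_quad p hz
  have hterm : (fun z => latTerm b c E z p) =
      (lin p ^ b * (fun z => conj (lin p z)) ^ c) • (E ∘ quad p) := rfl
  rw [hterm]
  refine ((((hasFDerivAt_lin p z).pow b).mul ((hasFDerivAt_conj_lin p z).pow c)).smul
    (hE.hasFDerivAt.comp z hD)).congr_fderiv ?_
  ext h
  have hsmul : D h • E' (quad p z) = (D h : ℂ) • E' (quad p z) := (Complex.coe_smul _ _).symm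
  simp only [add_apply, smul_apply, ContinuousLinearMap.comp_apply,
    ContinuousLinearMap.smulRight_apply, wirtingerL_apply, latDeriv, latTerm, hsmul, hD_apply,
    fst_eq_lin_sub_conj_div p hz, ContinuousLinearMap.toSpanSingleton_apply, Function.comp_apply,
    smul_eq_mul, Pi.mul_apply]
  rcases b with _ | b <;> rcases c with _ | c
  all_goals
    simp only [Nat.add_sub_cancel, Nat.cast_zero, zero_smul, zero_mul, mul_zero, zero_div]
    match_scalars <;> · push_cast; field_simp; try ring

lemma isBigO_latDeriv {E E' : ℝ → B} (hE : RapidDecay E) (hE' : RapidDecay E') (b c : ℕ)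
    (M : ℝ) {z : ℂ} (hz : 0 < z.im) :
    (fun x : ℂ × Pairs => latDeriv (fun b c E => latTerm b c E x.1 x.2) b c E E' x.1.im)
      =O[𝓝 z ×ˢ ⊤] fun x => ‖(x.2 : ℤ × ℤ)‖ ^ (-M) := by
  have hy : z.im ≠ 0 := hz.ne'
  have hcoeff (d : ℂ) : ContinuousAt (fun z : ℂ => d / (2 * Complex.I * z.im)) z := by
    fun_prop (disch := simpa)
  have hcoeff' : ContinuousAt (fun z : ℂ => Complex.I / (2 * (z.im : ℂ) ^ 2)) z := by
    fun_prop (disch := simpa)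
  have hterm (b c : ℕ) := hE.isBigO_latTerm b c M hz
  have hterm' (b c : ℕ) := hE'.isBigO_latTerm b c M hz
  exact .prod_left
    ((isBigO_smul_of_continuousAt (hcoeff b) ((hterm b c).sub (hterm (b - 1) (c + 1)))).add
      (isBigO_smul_of_continuousAt hcoeff' (hterm' b (c + 2))))
    ((isBigO_smul_of_continuousAt (hcoeff c) ((hterm (b + 1) (c - 1)).sub (hterm b c))).sub
      (isBigO_smul_of_continuousAt hcoeff' (hterm' (b + 2) c)))

variable [CompleteSpace B]

lemma hasFDerivAt_latSum {E E' : ℝ → B} (hE : ∀ q > 0, HasDerivAt E (E' q) q)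
    (hd : RapidDecay E) (hd' : RapidDecay E') (b c : ℕ) {z : ℂ} (hz : 0 < z.im) :
    HasFDerivAt (latSum b c E)
      (wirtingerL B (latDeriv (fun b c E => latSum b c E z) b c E E' z.im)) z := by
  have hterms : ∀ᶠ w in 𝓝 z, ∀ p : Pairs, HasFDerivAt (fun z => latTerm b c E z p)
      (wirtingerL B (latDeriv (fun b c E => latTerm b c E w p) b c E E' w.im)) w :=
    (eventually_im_pos hz).mono fun w hw p => hasFDerivAt_latTerm p b c hw (hE _ (quad_pos p hw))
  refine (hasFDerivAt_tsum_of_isBigO (summable_norm_pairs (by norm_num : (2 : ℝ) < 3))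
    (((wirtingerL B).isBigO_comp _ _).trans (isBigO_latDeriv hd hd' b c 3 hz)) hterms
    (hd.summable_latTerm b c hz).of_norm).congr_fderiv ?_
  have hsum (b c : ℕ) := hd.hasSum_latTerm b c hz
  have hsum' (b c : ℕ) := hd'.hasSum_latTerm b c hz
  have hholo := (((hsum b c).sub (hsum (b - 1) (c + 1))).const_smul
    ((b : ℂ) / (2 * Complex.I * z.im))).add
    ((hsum' b (c + 2)).const_smul (Complex.I / (2 * (z.im : ℂ) ^ 2)))
  have hanti := (((hsum (b + 1) (c - 1)).sub (hsum b c)).const_smul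
    ((c : ℂ) / (2 * Complex.I * z.im))).sub
    ((hsum' (b + 2) c).const_smul (Complex.I / (2 * (z.im : ℂ) ^ 2)))
  exact ((hholo.prodMk hanti).mapL (wirtingerL B)).tsum_eq

end LatticeSumDeriv

section Laplace

lemma rapidDecay_exp_neg {a : ℝ} (ha : 0 < a) : RapidDecay fun q => Real.exp (-a * q) := by
  intro M q₀ hq₀
  obtain ⟨n, hn⟩ := exists_nat_ge M
  refine isBigO_principal.2 ⟨n.factorial / a ^ n * q₀ ^ (M - n), fun q hq => ?_⟩
  have hq0 : 0 < q := hq₀.trans_le hq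
  rw [Real.norm_of_nonneg (Real.exp_pos _).le, Real.norm_of_nonneg (by positivity), neg_mul]
  calc Real.exp (-(a * q)) ≤ ((a * q) ^ n / n.factorial)⁻¹ := by
        rw [Real.exp_neg]
        gcongr
        exact Real.pow_div_factorial_le_exp _ (by positivity) n
    _ = n.factorial / a ^ n * q ^ (M - n) * q ^ (-M) := by
        rw [mul_assoc, ← Real.rpow_add hq0, mul_pow, inv_div, sub_add_eq_add_sub, add_neg_cancel,
          zero_sub, Real.rpow_neg hq0.le, Real.rpow_natCast]
        field_simp
    _ ≤ n.factorial / a ^ n * q₀ ^ (M - n) * q ^ (-M) := by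
        have := Real.rpow_le_rpow_of_nonpos hq₀ hq (sub_nonpos.2 hn)
        gcongr ?_ * ?_ * _

lemma Decays.ofReal {E : ℝ → ℝ} {N : ℝ} (hE : Decays E N) : Decays (fun q => (E q : ℂ)) N :=
  fun q₀ hq₀ => .of_norm_left <|
    (hE q₀ hq₀).norm_left.congr_left fun q => (Complex.norm_real (E q)).symm

variable {B : Type*} [NormedAddCommGroup B]

/-- Continuity and polynomial growth on `(1, ∞)`: the admissible weights of the incomplete
Laplace transform `lap`. -/
structure PolyGrowth (W : ℝ → B) : Prop where
  cont : ContinuousOn W (Ioi 1)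
  bound : ∃ n : ℕ, W =O[𝓟 (Ioi 1)] fun t => t ^ n

lemma PolyGrowth.norm {W : ℝ → B} (hW : PolyGrowth W) : PolyGrowth fun t => ‖W t‖ where
  cont := hW.cont.norm
  bound := hW.bound.imp fun _ hn => hn.norm_left

variable [NormedSpace ℝ B]

lemma PolyGrowth.neg_pi_mul_smul {W : ℝ → B} (hW : PolyGrowth W) :
    PolyGrowth fun t => (-(Real.pi * t)) • W t where
  cont := (by fun_prop : Continuous fun t : ℝ => -(Real.pi * t)).continuousOn.smul hW.cont
  bound := by
    obtain ⟨n, hn⟩ := hW.bound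
    refine ⟨n + 1, .congr_right (((isBigO_refl id _).const_mul_left Real.pi).neg_left.smul hn)
      fun t => ?_⟩
    rw [id, smul_eq_mul, pow_succ']

/-- The incomplete Laplace transform `∫_{t > 1} exp (-π t q) W(t) dt`. -/
def lap (W : ℝ → B) (q : ℝ) : B := ∫ t in Ioi (1 : ℝ), Real.exp (-(Real.pi * q) * t) • W t

lemma integrableOn_pow_mul_exp (n : ℕ) {a : ℝ} (ha : 0 < a) :
    IntegrableOn (fun t : ℝ => t ^ n * Real.exp (-a * t)) (Ioi 1) := by
  have h := integrableOn_rpow_mul_exp_neg_mul_rpow (s := n) (p := 1) (b := a)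
    (by linarith [n.cast_nonneg (α := ℝ)]) one_pos ha
  simp only [Real.rpow_natCast, Real.rpow_one] at h
  exact h.mono_set (Ioi_subset_Ioi zero_le_one)

lemma PolyGrowth.aestronglyMeasurable {W : ℝ → B} (hW : PolyGrowth W) (a : ℝ) :
    AEStronglyMeasurable (fun t => Real.exp (-a * t) • W t) (volume.restrict (Ioi 1)) :=
  ContinuousOn.aestronglyMeasurable ((by fun_prop : Continuous fun t : ℝ =>
    Real.exp (-a * t)).continuousOn.smul hW.cont) measurableSet_Ioi

lemma PolyGrowth.integrableOn {W : ℝ → B} (hW : PolyGrowth W) {a : ℝ} (ha : 0 < a) :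
    IntegrableOn (fun t => Real.exp (-a * t) • W t) (Ioi 1) := by
  obtain ⟨n, hn⟩ := hW.bound
  obtain ⟨C, hC⟩ := isBigO_principal.1 hn
  refine Integrable.mono' ((integrableOn_pow_mul_exp n ha).const_mul C)
    (hW.aestronglyMeasurable a) ?_
  filter_upwards [ae_restrict_mem measurableSet_Ioi] with t ht
  have ht0 : (0 : ℝ) < t := one_pos.trans ht
  rw [norm_smul, Real.norm_of_nonneg (Real.exp_pos _).le]
  calc Real.exp (-a * t) * ‖W t‖ ≤ Real.exp (-a * t) * (C * ‖t ^ n‖) := by gcongr; exact hC t ht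
    _ = C * (t ^ n * Real.exp (-a * t)) := by
      rw [Real.norm_of_nonneg (by positivity)]
      ring

lemma hasDerivAt_exp_neg_pi_mul (t x : ℝ) :
    HasDerivAt (fun x : ℝ => Real.exp (-(Real.pi * x) * t))
      (Real.exp (-(Real.pi * x) * t) * (-(Real.pi * t))) x := by
  have h : HasDerivAt (fun x : ℝ => -(Real.pi * x) * t) (-(Real.pi * 1) * t) x :=
    ((hasDerivAt_id x).const_mul Real.pi).neg.mul_const t
  exact h.exp.congr_deriv (by ring)

lemma hasDerivAt_lap {W : ℝ → B} (hW : PolyGrowth W) {q : ℝ} (hq : 0 < q) :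
    HasDerivAt (lap W) (lap (fun t => (-(Real.pi * t)) • W t) q) q := by
  have hW' := hW.neg_pi_mul_smul
  refine (hasDerivAt_integral_of_dominated_loc_of_deriv_le (𝕜 := ℝ)
    (F' := fun x t => Real.exp (-(Real.pi * x) * t) • (-(Real.pi * t)) • W t)
    (bound := fun t => ‖Real.exp (-(Real.pi * (q / 2)) * t) • (-(Real.pi * t)) • W t‖)
    (Ioi_mem_nhds (half_lt_self hq)) (.of_forall fun x => hW.aestronglyMeasurable _)
    (hW.integrableOn (by positivity)) (hW'.aestronglyMeasurable _) ?_
    (hW'.integrableOn (by positivity)).norm ?_).2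
  · filter_upwards [ae_restrict_mem measurableSet_Ioi] with t ht x hx
    have ht : (0 : ℝ) < t := one_pos.trans ht
    have hx : q / 2 < x := hx
    rw [norm_smul, norm_smul _ ((-(Real.pi * t)) • W t), Real.norm_of_nonneg (Real.exp_pos _).le,
      Real.norm_of_nonneg (Real.exp_pos _).le]
    gcongr
  · refine .of_forall fun t x _ => ?_
    rw [smul_smul]
    exact (hasDerivAt_exp_neg_pi_mul t x).smul_const (W t)

lemma norm_lap_le {W : ℝ → B} (hW : PolyGrowth W) {q₀ q : ℝ} (hq₀ : 0 < q₀) (hq : q₀ ≤ q) :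
    ‖lap W q‖ ≤ lap (fun t => ‖W t‖) (q₀ / 2) * Real.exp (-(Real.pi / 2) * q) := by
  refine (norm_integral_le_integral_norm _).trans ?_
  rw [lap, ← integral_mul_const]
  refine integral_mono_of_nonneg (.of_forall fun _ => norm_nonneg _)
    ((hW.norm.integrableOn (by positivity)).mul_const _) ?_
  filter_upwards [ae_restrict_mem measurableSet_Ioi] with t ht
  have ht : 1 < t := ht
  rw [norm_smul, Real.norm_of_nonneg (Real.exp_pos _).le, smul_eq_mul, mul_right_comm,
    ← Real.exp_add]
  gcongr
  -- both `q₀ t` and `q` are at most `q t`, so `(q₀ t + q) / 2 ≤ q t`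
  have hq₀t : q₀ * t ≤ q * t := by gcongr
  have hqt : q ≤ q * t := le_mul_of_one_le_right (hq₀.le.trans hq) ht.le
  nlinarith [Real.pi_pos]

lemma rapidDecay_lap {W : ℝ → B} (hW : PolyGrowth W) : RapidDecay (lap W) := by
  intro M q₀ hq₀
  have hexp := (rapidDecay_exp_neg (half_pos Real.pi_pos) M q₀ hq₀).const_mul_left
    (lap (fun t => ‖W t‖) (q₀ / 2))
  exact (isBigO_principal.2 ⟨1, fun q hq => by
    rw [one_mul]
    exact (norm_lap_le hW hq₀ hq).trans (le_abs_self _)⟩).trans hexp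

end Laplace

section Smoothness

variable {B : Type*} [NormedAddCommGroup B] [NormedSpace ℂ B]

lemma isOpen_im_pos : IsOpen {z : ℂ | 0 < z.im} := isOpen_lt continuous_const Complex.continuous_im

lemma contDiffOn_latDeriv {T : ℕ → ℕ → (ℝ → B) → ℂ → B} {n : ℕ∞} {b c : ℕ} {E E' : ℝ → B}
    (hT : ∀ b c, ContDiffOn ℝ n (T b c E) {z : ℂ | 0 < z.im})
    (hT' : ∀ b c, ContDiffOn ℝ n (T b c E') {z : ℂ | 0 < z.im}) :
    ContDiffOn ℝ n (fun z => latDeriv (fun b c E => T b c E z) b c E E' z.im)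
      {z : ℂ | 0 < z.im} := by
  have him : ContDiffOn ℝ n (fun z : ℂ => (z.im : ℂ)) {z : ℂ | 0 < z.im} :=
    (Complex.ofRealCLM.contDiff.comp Complex.imCLM.contDiff).contDiffOn
  have hinv : ContDiffOn ℝ n (fun z : ℂ => (z.im : ℂ)⁻¹) {z : ℂ | 0 < z.im} :=
    him.inv fun z (hz : 0 < Complex.im z) => Complex.ofReal_ne_zero.2 hz.ne'
  have hcoeff (d : ℂ) : ContDiffOn ℝ n (fun z : ℂ => d / (2 * Complex.I * z.im))
      {z : ℂ | 0 < z.im} :=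
    ((contDiffOn_const (c := d / (2 * Complex.I))).mul hinv).congr fun z _ => by
      rw [← div_eq_mul_inv, div_div]
  have hcoeff' : ContDiffOn ℝ n (fun z : ℂ => Complex.I / (2 * (z.im : ℂ) ^ 2))
      {z : ℂ | 0 < z.im} :=
    ((contDiffOn_const (c := Complex.I / 2)).mul (hinv.pow 2)).congr fun z _ => by
      rw [inv_pow, ← div_eq_mul_inv, div_div]
  exact (((hcoeff b).smul ((hT b c).sub (hT (b - 1) (c + 1)))).add
    (hcoeff'.smul (hT' b (c + 2)))).prodMk
      (((hcoeff c).smul ((hT (b + 1) (c - 1)).sub (hT b c))).sub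
        (hcoeff'.smul (hT' (b + 2) c)))

variable [CompleteSpace B]

lemma hasFDerivAt_latSum_lap {W : ℝ → B} (hW : PolyGrowth W) (b c : ℕ) {z : ℂ} (hz : 0 < z.im) :
    HasFDerivAt (latSum b c (lap W)) (wirtingerL B (latDeriv (fun b c E => latSum b c E z) b c
      (lap W) (lap fun t => (-(Real.pi * t)) • W t) z.im)) z :=
  hasFDerivAt_latSum (fun _ hq => hasDerivAt_lap hW hq) (rapidDecay_lap hW)
    (rapidDecay_lap hW.neg_pi_mul_smul) b c hz

lemma contDiffOn_latSum_lap_nat (n : ℕ) {W : ℝ → B} (hW : PolyGrowth W) (b c : ℕ) :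
    ContDiffOn ℝ n (latSum b c (lap W)) {z : ℂ | 0 < z.im} := by
  induction n generalizing W b c with
  | zero =>
    exact contDiffOn_zero.2 fun z hz =>
      (hasFDerivAt_latSum_lap hW b c hz).continuousAt.continuousWithinAt
  | succ n ih =>
    rw [Nat.cast_succ, contDiffOn_succ_iff_fderiv_of_isOpen isOpen_im_pos]
    refine ⟨fun z hz => (hasFDerivAt_latSum_lap hW b c hz).differentiableAt.differentiableWithinAt,
      by simp, ?_⟩
    exact ((wirtingerL B).contDiff.comp_contDiffOn
      (contDiffOn_latDeriv (ih hW) (ih hW.neg_pi_mul_smul))).congr fun z hz =>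
        (hasFDerivAt_latSum_lap hW b c hz).fderiv

lemma contDiffOn_latSum_lap {W : ℝ → B} (hW : PolyGrowth W) (b c : ℕ) :
    ContDiffOn ℝ ∞ (latSum b c (lap W)) {z : ℂ | 0 < z.im} :=
  contDiffOn_infty.2 fun n => contDiffOn_latSum_lap_nat n hW b c

end Smoothness

section Gauss

/-- The Gaussian profile `exp (-π t q)`. -/
def gauss (t q : ℝ) : ℂ := (Real.exp (-(Real.pi * t) * q) : ℂ)

lemma conj_gauss (t q : ℝ) : conj (gauss t q) = gauss t q := Complex.conj_ofReal _

lemma hasDerivAt_gauss (t q : ℝ) : HasDerivAt (gauss t) ((-(Real.pi * t) : ℂ) • gauss t q) q := by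
  have h : HasDerivAt (fun q : ℝ => -(Real.pi * t) * q) (-(Real.pi * t) * 1) q :=
    (hasDerivAt_id q).const_mul _
  refine h.exp.ofReal_comp.congr_deriv ?_
  simp [gauss, mul_comm]

lemma hasDerivAt_gauss_left (t q : ℝ) :
    HasDerivAt (fun t => gauss t q) (-Real.pi * (q : ℂ) • gauss t q) t := by
  have h : HasDerivAt (fun t : ℝ => -(Real.pi * t) * q) (-(Real.pi * 1) * q) t :=
    ((hasDerivAt_id t).const_mul Real.pi).neg.mul_const q
  refine h.exp.ofReal_comp.congr_deriv ?_
  simp only [gauss, smul_eq_mul]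
  push_cast
  ring

lemma norm_gauss (t q : ℝ) : ‖gauss t q‖ = Real.exp (-(Real.pi * t) * q) := by
  rw [gauss, Complex.norm_real, Real.norm_of_nonneg (Real.exp_pos _).le]

lemma rapidDecay_gauss {t : ℝ} (ht : 0 < t) : RapidDecay (gauss t) :=
  fun M => (rapidDecay_exp_neg (mul_pos Real.pi_pos ht) M).ofReal

variable {B : Type*} [NormedAddCommGroup B] [NormedSpace ℂ B]

lemma RapidDecay.const_smul {E : ℝ → B} (hE : RapidDecay E) (a : ℂ) :
    RapidDecay fun q => a • E q :=
  fun N q₀ hq₀ => (hE N q₀ hq₀).const_smul_left a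

lemma RapidDecay.mul_id {E : ℝ → B} (hE : RapidDecay E) : RapidDecay fun q => (q : ℂ) • E q := by
  intro N q₀ hq₀
  have hid : (fun q : ℝ => (q : ℂ)) =O[𝓟 (Ici q₀)] (fun q => q) :=
    .of_norm_left (isBigO_refl _ _ |>.norm_left |>.congr_left fun q => (Complex.norm_real q).symm)
  refine (hid.smul (hE (N + 1) q₀ hq₀)).congr' .rfl ?_
  filter_upwards [mem_principal_self (Ici q₀)] with q hq
  have hq0 : 0 < q := hq₀.trans_le hq
  rw [smul_eq_mul, neg_add', Real.rpow_sub_one hq0.ne', mul_div_cancel₀ _ hq0.ne']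

lemma latSum_const_smul (b c : ℕ) (a : ℂ) (E : ℝ → B) (z : ℂ) :
    latSum b c (fun q => a • E q) z = a • latSum b c E z := by
  simp only [latSum, latTerm, smul_comm _ a]
  exact tsum_const_smul'' a

lemma latSum_conj {E : ℝ → ℂ} (b c : ℕ) (z : ℂ) :
    conj (latSum b c E z) = latSum c b (fun q => conj (E q)) z := by
  rw [latSum, latSum, Complex.conj_tsum]
  refine tsum_congr fun p => ?_
  simp only [latTerm, smul_eq_mul, map_mul, map_pow, Complex.conj_conj]
  ring

end Gauss

section Poisson

lemma summable_gaussian {a : ℝ} (ha : 0 < a) :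
    Summable fun n : ℤ => Real.exp (-(Real.pi * a) * (n : ℝ) ^ 2) := by
  have h := ((summable_jacobiTheta₂_term_iff 0 (Complex.I * a)).2 (by simpa using ha)).norm
  refine h.congr fun n => ?_
  rw [jacobiTheta₂_term, Complex.norm_exp, mul_zero, zero_add]
  congr 1
  have hreal : (Real.pi * Complex.I * (n : ℂ) ^ 2 * (Complex.I * a) : ℂ) =
      ((-(Real.pi * a) * (n : ℝ) ^ 2 : ℝ) : ℂ) := by
    push_cast
    linear_combination (Real.pi * (n : ℂ) ^ 2 * a : ℂ) * Complex.I_sq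
  rw [hreal, Complex.ofReal_re]

/-- The summand obtained from the Gaussian lattice sum by Poisson summation in one variable. -/
def poissonTerm (t : ℝ) (z : ℂ) (p : ℤ × ℤ) : ℂ :=
  Complex.exp (-(Real.pi * (t * z.im)) * (p.1 : ℂ) ^ 2 - Real.pi * (z.im / t) * (p.2 : ℂ) ^ 2 +
    2 * Real.pi * Complex.I * p.1 * p.2 * z.re)

lemma norm_poissonTerm (t : ℝ) (z : ℂ) (p : ℤ × ℤ) : ‖poissonTerm t z p‖ =
    Real.exp (-(Real.pi * (t * z.im)) * (p.1 : ℝ) ^ 2) *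
      Real.exp (-(Real.pi * (z.im / t)) * (p.2 : ℝ) ^ 2) := by
  rw [poissonTerm, Complex.norm_exp, ← Real.exp_add]
  congr 1
  have hsplit : (-(Real.pi * (t * z.im)) * (p.1 : ℂ) ^ 2 - Real.pi * (z.im / t) * (p.2 : ℂ) ^ 2 +
      2 * Real.pi * Complex.I * p.1 * p.2 * z.re : ℂ) =
      ((-(Real.pi * (t * z.im)) * (p.1 : ℝ) ^ 2 +
        -(Real.pi * (z.im / t)) * (p.2 : ℝ) ^ 2 : ℝ) : ℂ) +
      ((2 * Real.pi * p.1 * p.2 * z.re : ℝ) : ℂ) * Complex.I := by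
    push_cast
    ring
  rw [hsplit, Complex.add_re, Complex.ofReal_re, Complex.re_ofReal_mul, Complex.I_re, mul_zero,
    add_zero]

lemma summable_poissonTerm {t : ℝ} (ht : 0 < t) {z : ℂ} (hz : 0 < z.im) :
    Summable (poissonTerm t z) := by
  refine Summable.of_norm ?_
  simp only [norm_poissonTerm]
  exact Summable.mul_of_nonneg (summable_gaussian (by positivity))
    (summable_gaussian (by positivity)) (fun _ => (Real.exp_pos _).le)
    (fun _ => (Real.exp_pos _).le)

lemma poissonTerm_one_div_swap (t : ℝ) (z : ℂ) (p : ℤ × ℤ) :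
    poissonTerm (1 / t) z p.swap = poissonTerm t z p := by
  simp only [poissonTerm, Prod.fst_swap, Prod.snd_swap]
  congr 1
  push_cast
  rw [div_div_eq_mul_div]
  ring

lemma ofReal_quad (p : ℤ × ℤ) (z : ℂ) : (quad p z : ℂ) =
    (Complex.normSq z * p.1 ^ 2 + 2 * p.1 * p.2 * z.re + p.2 ^ 2) / z.im := by
  have hnorm : Complex.normSq (lin p z) =
      Complex.normSq z * p.1 ^ 2 + 2 * p.1 * p.2 * z.re + p.2 ^ 2 := by
    simp only [lin, Complex.normSq_apply, Complex.add_re, Complex.mul_re, Complex.intCast_re,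
      Complex.intCast_im, zero_mul, sub_zero, Complex.add_im, Complex.mul_im, add_zero]
    ring
  rw [quad, hnorm]
  push_cast
  ring

lemma gauss_quad_eq (t : ℝ) {z : ℂ} (hz : 0 < z.im) (p : ℤ × ℤ) :
    gauss t (quad p z) = Complex.exp (-(Real.pi * t * Complex.normSq z / z.im) * (p.1 : ℂ) ^ 2) *
      Complex.exp (-Real.pi * (t / z.im : ℂ) * (p.2 : ℂ) ^ 2 +
        2 * Real.pi * (-(t * p.1 * z.re / z.im) : ℂ) * p.2) := by
  have hy : (z.im : ℂ) ≠ 0 := Complex.ofReal_ne_zero.2 hz.ne'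
  rw [gauss, Complex.ofReal_exp, ← Complex.exp_add]
  congr 1
  push_cast
  rw [ofReal_quad]
  field_simp
  ring

lemma tsum_gauss_row {t : ℝ} (ht : 0 < t) {z : ℂ} (hz : 0 < z.im) (m : ℤ) :
    ∑' n : ℤ, gauss t (quad (m, n) z) =
      1 / (t / z.im : ℂ) ^ (1 / 2 : ℂ) * ∑' n : ℤ, poissonTerm t z (m, n) := by
  have hy : (z.im : ℂ) ≠ 0 := Complex.ofReal_ne_zero.2 hz.ne'
  have ht' : (t : ℂ) ≠ 0 := Complex.ofReal_ne_zero.2 ht.ne'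
  simp only [gauss_quad_eq t hz]
  rw [tsum_mul_left, Complex.tsum_exp_neg_quadratic (a := (t / z.im : ℂ))
    (by rw [← Complex.ofReal_div, Complex.ofReal_re]; positivity), mul_left_comm, ← tsum_mul_left]
  congr 2
  ext n
  rw [← Complex.exp_add, poissonTerm]
  congr 1
  have hnorm : (Complex.normSq z : ℂ) = (z.re : ℂ) ^ 2 + (z.im : ℂ) ^ 2 := by
    rw [Complex.normSq_apply]
    push_cast
    ring
  rw [hnorm]
  field_simp
  ring_nf
  simp only [Complex.I_sq]
  ring

end Poisson

section Theta

/-- The theta series of the lattice `ℤ z + ℤ` with spherical polynomial `u ^ b * conj u ^ c`. The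
origin contributes `0 ^ (b + c)`. -/
def theta (b c : ℕ) (t : ℝ) (z : ℂ) : ℂ := 0 ^ (b + c) + latSum b c (gauss t) z

lemma conj_theta (b c : ℕ) (t : ℝ) (z : ℂ) : conj (theta b c t z) = theta c b t z := by
  simp only [theta, map_add, map_pow, map_zero, latSum_conj, conj_gauss, add_comm c b]

lemma hasSum_gauss_quad {t : ℝ} (ht : 0 < t) {z : ℂ} (hz : 0 < z.im) :
    HasSum (fun p : ℤ × ℤ => gauss t (quad p z)) (theta 0 0 t z) := by
  have h := (rapidDecay_gauss ht).hasSum_latTerm 0 0 hz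
  simp only [latTerm, pow_zero, mul_one, one_smul] at h
  have horigin : gauss t (quad (0, 0) z) = 1 := by simp [gauss, quad, lin]
  have hcompl := (Finset.hasSum_compl_iff (f := fun p : ℤ × ℤ => gauss t (quad p z)) {(0, 0)}).1
    ((Equiv.subtypeEquivRight (p := fun p : ℤ × ℤ => p ∉ ({(0, 0)} : Finset (ℤ × ℤ)))
      (q := fun p => p ≠ (0, 0)) (by simp)).hasSum_iff.2 h)
  rwa [Finset.sum_singleton, horigin, add_comm] at hcompl

lemma theta_zero_eq_tsum_poissonTerm {t : ℝ} (ht : 0 < t) {z : ℂ} (hz : 0 < z.im) :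
    theta 0 0 t z = 1 / (t / z.im : ℂ) ^ (1 / 2 : ℂ) * ∑' p, poissonTerm t z p := by
  have hs := hasSum_gauss_quad ht hz
  rw [← hs.tsum_eq, hs.summable.tsum_prod, (summable_poissonTerm ht hz).tsum_prod,
    ← tsum_mul_left]
  exact tsum_congr fun m => tsum_gauss_row ht hz m

lemma ofReal_div_cpow_half {t y : ℝ} (ht : 0 < t) (hy : 0 < y) :
    (t / y : ℂ) ^ (1 / 2 : ℂ) = t * ((1 / t : ℝ) / y : ℂ) ^ (1 / 2 : ℂ) := by
  have hsqrt {x : ℝ} (hx : 0 ≤ x) : (x : ℂ) ^ (1 / 2 : ℂ) = (√x : ℝ) := by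
    rw [Real.sqrt_eq_rpow, Complex.ofReal_cpow hx]
    norm_num
  rw [← Complex.ofReal_div, ← Complex.ofReal_div, hsqrt (by positivity), hsqrt (by positivity),
    ← Complex.ofReal_mul]
  congr 1
  rw [← Real.sqrt_sq ht.le, ← Real.sqrt_mul (by positivity), Real.sqrt_sq ht.le]
  congr 1
  field_simp

lemma theta_zero_one_div {t : ℝ} (ht : 0 < t) {z : ℂ} (hz : 0 < z.im) :
    theta 0 0 (1 / t) z = t * theta 0 0 t z := by
  have ht' : (t : ℂ) ≠ 0 := Complex.ofReal_ne_zero.2 ht.ne'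
  have hsum : ∑' p, poissonTerm (1 / t) z p = ∑' p, poissonTerm t z p := by
    rw [← (Equiv.prodComm ℤ ℤ).tsum_eq (poissonTerm (1 / t) z)]
    exact tsum_congr (poissonTerm_one_div_swap t z)
  rw [theta_zero_eq_tsum_poissonTerm ht hz,
    theta_zero_eq_tsum_poissonTerm (one_div_pos.2 ht) hz, hsum, ofReal_div_cpow_half ht hz]
  field_simp

lemma differentiableAt_theta {t : ℝ} (ht : 0 < t) (b c : ℕ) {z : ℂ} (hz : 0 < z.im) :
    DifferentiableAt ℝ (theta b c t) z :=
  (differentiableAt_const _).add (hasFDerivAt_latSum (fun q _ => hasDerivAt_gauss t q)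
    (rapidDecay_gauss ht) ((rapidDecay_gauss ht).const_smul _) b c hz).differentiableAt

lemma dbarC_theta {t : ℝ} (ht : 0 < t) (a : ℕ) {z : ℂ} (hz : 0 < z.im) :
    dbarC (theta a 0 t) z =
      Complex.I / (2 * (z.im : ℂ) ^ 2) * (Real.pi * t) * theta (a + 2) 0 t z := by
  have hd := (hasFDerivAt_latSum (fun q _ => hasDerivAt_gauss t q) (rapidDecay_gauss ht)
    ((rapidDecay_gauss ht).const_smul _) a 0 hz)
  have hsum : theta a 0 t = fun w => 0 ^ a + latSum a 0 (gauss t) w := rfl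
  rw [hsum, dbarC_add (differentiableAt_const _) hd.differentiableAt, dbarC_const, zero_add,
    dbarC_of_hasFDerivAt hd, theta, zero_pow (by lia), zero_add]
  simp only [latDeriv, Nat.cast_zero, zero_div, zero_smul, zero_sub]
  rw [latSum_const_smul, smul_eq_mul, smul_eq_mul]
  ring

lemma theta_one_div_holo {t : ℝ} (ht : 0 < t) (j : ℕ) {z : ℂ} (hz : 0 < z.im) :
    theta (2 * j) 0 (1 / t) z = (t : ℂ) ^ (2 * j + 1) * theta (2 * j) 0 t z := by
  induction j generalizing z with
  | zero => simpa using theta_zero_one_div ht hz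
  | succ j ih =>
    -- applying `∂/∂z̄` to the law for `2 j` yields the law for `2 j + 2`
    have hdbar : dbarC (theta (2 * j) 0 (1 / t)) z =
        (t : ℂ) ^ (2 * j + 1) * dbarC (theta (2 * j) 0 t) z :=
      (dbarC_congr ((eventually_im_pos hz).mono fun w hw => ih hw)).trans
        (dbarC_const_smul (differentiableAt_theta ht _ _ hz) _)
    rw [dbarC_theta ht _ hz, dbarC_theta (one_div_pos.2 ht) _ hz] at hdbar
    have hy : (z.im : ℂ) ≠ 0 := Complex.ofReal_ne_zero.2 hz.ne'
    have ht' : (t : ℂ) ≠ 0 := Complex.ofReal_ne_zero.2 ht.ne'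
    have hpi : (Real.pi : ℂ) ≠ 0 := Complex.ofReal_ne_zero.2 Real.pi_ne_zero
    push_cast at hdbar
    field_simp at hdbar
    rw [mul_add, mul_one, hdbar]
    ring

lemma theta_one_div {t : ℝ} (ht : 0 < t) {b c : ℕ} (hbc : b = 0 ∨ c = 0) (hev : Even (b + c))
    {z : ℂ} (hz : 0 < z.im) :
    theta b c (1 / t) z = (t : ℂ) ^ (b + c + 1) * theta b c t z := by
  obtain ⟨j, hj⟩ := hev
  rw [← two_mul] at hj
  rcases hbc with rfl | rfl
  · obtain rfl : c = 2 * j := by lia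
    rw [← conj_theta, theta_one_div_holo ht j hz, map_mul, conj_theta, map_pow,
      Complex.conj_ofReal, zero_add]
  · obtain rfl : b = 2 * j := by lia
    exact theta_one_div_holo ht j hz

lemma hasDerivAt_theta (b c : ℕ) {z : ℂ} (hz : 0 < z.im) {t : ℝ} (ht : 0 < t) :
    HasDerivAt (fun t => theta b c t z)
      (-Real.pi * latSum b c (fun q => (q : ℂ) • gauss t q) z) t := by
  have hbound := ((rapidDecay_gauss (half_pos ht)).mul_id.summable_latTerm b c hz).mul_left Real.pi
  have hterm (p : Pairs) (s : ℝ) : HasDerivAt (fun t => latTerm b c (gauss t) z p)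
      (-Real.pi * latTerm b c (fun q => (q : ℂ) • gauss s q) z p) s := by
    refine ((hasDerivAt_gauss_left s (quad p z)).const_mul
      (lin p z ^ b * conj (lin p z) ^ c)).congr_deriv ?_
    simp only [latTerm, smul_eq_mul]
    ring
  have hmem : t ∈ Ioi (t / 2) := half_lt_self ht
  have hsum := hasDerivAt_tsum_of_isPreconnected hbound isOpen_Ioi isPreconnected_Ioi
    (fun p s _ => hterm p s) (fun p s (hs : t / 2 < s) => by
      have hq := quad_pos p hz
      rw [norm_mul, norm_neg, Complex.norm_real, Real.norm_of_nonneg Real.pi_pos.le]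
      simp only [latTerm, norm_smul, norm_gauss]
      gcongr) hmem ((rapidDecay_gauss ht).summable_latTerm b c hz).of_norm hmem
  rw [tsum_mul_left] at hsum
  exact hsum.const_add _

lemma two_pi_mul_latSum_gauss_one {b c : ℕ} (hbc : b = 0 ∨ c = 0) (hev : Even (b + c))
    {z : ℂ} (hz : 0 < z.im) :
    2 * Real.pi * latSum b c (fun q => (q : ℂ) • gauss 1 q) z =
      ((b + c : ℕ) + 1 : ℂ) * theta b c 1 z := by
  -- differentiate the transformation law at its fixed point `t = 1`
  set D : ℂ := -Real.pi * latSum b c (fun q => (q : ℂ) • gauss 1 q) z with hD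
  have hright : HasDerivAt (fun t => theta b c t z) D 1 := hasDerivAt_theta b c hz one_pos
  have hinv : HasDerivAt (fun t : ℝ => 1 / t) (-1) 1 := by
    simpa using hasDerivAt_inv (one_ne_zero (α := ℝ))
  have hleft : HasDerivAt (fun t : ℝ => theta b c (1 / t) z) (-D) 1 := by
    have h1 : HasDerivAt (fun t => theta b c t z) D (1 / 1) := by rwa [one_div_one]
    exact (h1.scomp 1 hinv).congr_deriv (neg_one_smul ℝ D)
  have hpow : HasDerivAt (fun t : ℝ => (t : ℂ) ^ (b + c + 1)) ((b + c : ℕ) + 1 : ℂ) 1 :=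
    ((hasDerivAt_id (1 : ℝ)).ofReal_comp.pow (b + c + 1)).congr_deriv (by simp)
  have heq : (fun t : ℝ => theta b c (1 / t) z) =ᶠ[𝓝 1]
      fun t : ℝ => (t : ℂ) ^ (b + c + 1) * theta b c t z :=
    (lt_mem_nhds (one_pos (α := ℝ))).mono fun t ht => theta_one_div ht hbc hev hz
  have huniq := (hleft.congr_of_eventuallyEq heq.symm).unique (hpow.mul hright)
  simp only [Complex.ofReal_one, one_pow, one_mul] at huniq
  linear_combination huniq - 2 * hD

end Theta

section LaplaceOfLatticeSum

variable {B : Type*} [NormedAddCommGroup B]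

lemma RapidDecay.add {E F : ℝ → B} (hE : RapidDecay E) (hF : RapidDecay F) :
    RapidDecay fun q => E q + F q :=
  fun N q₀ hq₀ => (hE N q₀ hq₀).add (hF N q₀ hq₀)

lemma PolyGrowth.add {V W : ℝ → B} (hV : PolyGrowth V) (hW : PolyGrowth W) :
    PolyGrowth fun t => V t + W t where
  cont := hV.cont.add hW.cont
  bound := by
    obtain ⟨m, hm⟩ := hV.bound
    obtain ⟨n, hn⟩ := hW.bound
    have hpow {i j : ℕ} (hij : i ≤ j) :
        (fun t : ℝ => t ^ i) =O[𝓟 (Ioi 1)] fun t => t ^ j := by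
      refine .of_bound' (eventually_principal.2 fun t (ht : 1 < t) => ?_)
      have ht0 : 0 < t := one_pos.trans ht
      rw [Real.norm_of_nonneg (by positivity), Real.norm_of_nonneg (by positivity)]
      exact pow_le_pow_right₀ ht.le hij
    exact ⟨m + n, (hm.trans (hpow le_self_add)).add (hn.trans (hpow le_add_self))⟩

lemma polyGrowth_cpow (s : ℂ) : PolyGrowth fun t : ℝ => (t : ℂ) ^ s where
  cont t ht := by
    have hslit : (t : ℂ) ∈ Complex.slitPlane :=
      Complex.ofReal_mem_slitPlane.2 (one_pos.trans ht)
    exact (by fun_prop (disch := assumption) :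
      ContinuousAt (fun t : ℝ => (t : ℂ) ^ s) t).continuousWithinAt
  bound := by
    refine ⟨⌈s.re⌉₊, .of_bound' (eventually_principal.2 fun t (ht : 1 < t) => ?_)⟩
    rw [Complex.norm_cpow_eq_rpow_re_of_pos (one_pos.trans ht),
      Real.norm_of_nonneg (by positivity), ← Real.rpow_natCast]
    exact Real.rpow_le_rpow_of_exponent_le ht.le (Nat.le_ceil _)

lemma lap_add [NormedSpace ℝ B] {V W : ℝ → B} (hV : PolyGrowth V) (hW : PolyGrowth W) {q : ℝ}
    (hq : 0 < q) : lap (fun t => V t + W t) q = lap V q + lap W q := by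
  have hpos : 0 < Real.pi * q := by positivity
  simp only [lap, smul_add]
  exact integral_add (hV.integrableOn hpos) (hW.integrableOn hpos)

variable [NormedSpace ℂ B]

lemma latSum_congr {E F : ℝ → B} (h : ∀ q > 0, E q = F q) (b c : ℕ) {z : ℂ} (hz : 0 < z.im) :
    latSum b c E z = latSum b c F z :=
  tsum_congr fun p => by rw [latTerm, latTerm, h _ (quad_pos p hz)]

lemma latSum_add [CompleteSpace B] {E F : ℝ → B} (hE : RapidDecay E) (hF : RapidDecay F)
    (b c : ℕ) {z : ℂ} (hz : 0 < z.im) :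
    latSum b c (fun q => E q + F q) z = latSum b c E z + latSum b c F z := by
  simp only [latSum, latTerm, smul_add]
  exact ((hE.hasSum_latTerm b c hz).add (hF.hasSum_latTerm b c hz)).tsum_eq

lemma hasSum_integral_latTerm {W : ℝ → ℂ} (hW : PolyGrowth W) (b c : ℕ) {z : ℂ}
    (hz : 0 < z.im) :
    HasSum (fun p : Pairs => latTerm b c (lap W) z p)
      (∫ t in Ioi (1 : ℝ), ∑' p : Pairs, (lin p z ^ b * conj (lin p z) ^ c) *
        Real.exp (-(Real.pi * quad p z) * t) • W t) := by
  have hnorm := RapidDecay.summable_latTerm (fun N => (rapidDecay_lap hW.norm N).ofReal) b c hz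
  have hlap := hasSum_integral_of_summable_integral_norm (μ := volume.restrict (Ioi (1 : ℝ)))
    (F := fun (p : Pairs) t => (lin p z ^ b * conj (lin p z) ^ c) *
      Real.exp (-(Real.pi * quad p z) * t) • W t)
    (fun p => (hW.integrableOn (mul_pos Real.pi_pos (quad_pos p hz))).const_mul _)
    (hnorm.congr fun p => ?_)
  · simp only [integral_const_mul] at hlap
    exact hlap
  · rw [latTerm, norm_smul, Complex.norm_real, lap,
      Real.norm_of_nonneg (integral_nonneg fun t => by positivity), ← integral_const_mul]
    simp only [norm_mul, norm_smul, smul_eq_mul, Real.norm_of_nonneg (Real.exp_pos _).le]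

lemma integral_mul_latSum_gauss {W : ℝ → ℂ} (hW : PolyGrowth W) (b c : ℕ) {z : ℂ}
    (hz : 0 < z.im) :
    ∫ t in Ioi (1 : ℝ), W t * latSum b c (gauss t) z = latSum b c (lap W) z := by
  rw [latSum, (hasSum_integral_latTerm hW b c hz).tsum_eq]
  refine setIntegral_congr_fun measurableSet_Ioi fun t _ => ?_
  simp only [latSum]
  rw [← tsum_mul_left]
  refine tsum_congr fun p => ?_
  have hexp : -(Real.pi * t) * quad p z = -(Real.pi * quad p z) * t := by ring
  simp only [latTerm, gauss, Complex.real_smul, smul_eq_mul]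
  rw [hexp]
  ring

lemma isBigO_latSum_gauss (b c : ℕ) {z : ℂ} (hz : 0 < z.im) (r : ℝ) :
    (fun t => latSum b c (gauss t) z) =O[atTop] fun t : ℝ => t ^ r := by
  obtain ⟨δ, hδ, hquad⟩ := exists_eventually_le_quad hz
  have hle (p : Pairs) : δ ≤ quad p z :=
    (le_mul_of_one_le_right hδ.le (one_le_pow₀ (one_le_norm_pairs p))).trans
      (hquad.self_of_nhds p)
  have hs := (rapidDecay_gauss (t := 1 / 2) (by norm_num)).summable_latTerm b c hz
  refine IsBigO.trans (.of_bound (∑' p : Pairs, ‖latTerm b c (gauss (1 / 2)) z p‖) ?_)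
    (isLittleO_exp_neg_mul_rpow_atTop (a := Real.pi * δ / 2) (by positivity) r).isBigO
  filter_upwards [eventually_ge_atTop 1] with t ht
  rw [Real.norm_of_nonneg (Real.exp_pos _).le, ← tsum_mul_right]
  refine tsum_of_norm_bounded (hs.mul_right _).hasSum fun p => ?_
  simp only [latTerm, norm_smul, norm_gauss]
  rw [mul_assoc, ← Real.exp_add]
  gcongr
  -- both `δ t` and `quad p z` are at most `quad p z * t`
  have hδt : δ * t ≤ quad p z * t := by gcongr; exact hle p
  have hqt : quad p z ≤ quad p z * t := le_mul_of_one_le_right (quad_pos p hz).le ht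
  nlinarith [Real.pi_pos]

end LaplaceOfLatticeSum

section FunctionalEquationPair

variable {F : Type*} [NormedAddCommGroup F] [NormedSpace ℂ F] (P : WeakFEPair F)

/-- The restriction of `f - f₀` to `(1, ∞)`, for a pair of functions related by a functional
equation. -/
def upperPart : ℝ → F := (Ioi 1).indicator fun t => P.f t - P.f₀

lemma upperPart_eq_indicator_f_modif : upperPart P = (Ioi 1).indicator P.f_modif := by
  refine indicator_congr fun t ht => ?_
  have hnot : t ∉ Ioo (0 : ℝ) 1 := fun h => ht.not_gt h.2
  rw [WeakFEPair.f_modif, Pi.add_apply, indicator_of_mem ht, indicator_of_notMem hnot, add_zero]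

lemma f_modif_eq_upperPart_add {t : ℝ} (ht : 0 < t) :
    P.f_modif t = upperPart P t + (t : ℂ) ^ (-(P.k : ℂ)) • P.ε • upperPart P.symm t⁻¹ := by
  have hcpow : (t : ℂ) ^ (-(P.k : ℂ)) = (t ^ (-P.k) : ℝ) := by
    rw [Complex.ofReal_cpow ht.le, Complex.ofReal_neg]
  rcases lt_trichotomy t 1 with hlt | rfl | hgt
  · have hnot : t ∉ Ioi (1 : ℝ) := hlt.not_gt
    have hmem : t⁻¹ ∈ Ioi (1 : ℝ) := (one_lt_inv₀ ht).2 hlt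
    have hfeq := P.h_feq t⁻¹ (inv_pos.2 ht)
    rw [one_div, inv_inv, Real.inv_rpow ht.le, ← Real.rpow_neg ht.le] at hfeq
    rw [WeakFEPair.f_modif, Pi.add_apply, upperPart, upperPart,
      indicator_of_notMem hnot, zero_add, zero_add,
      indicator_of_mem (mem_Ioo.2 ⟨ht, hlt⟩), indicator_of_mem hmem, hfeq, hcpow, smul_smul,
      smul_sub, mul_comm (P.ε)]
    rfl
  · simp [WeakFEPair.f_modif, upperPart]
  · have hnot : t⁻¹ ∉ Ioi (1 : ℝ) := fun h => hgt.not_gt ((one_lt_inv₀ ht).1 h)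
    rw [upperPart_eq_indicator_f_modif, indicator_of_mem (mem_Ioi.2 hgt), upperPart,
      indicator_of_notMem hnot, smul_zero, smul_zero, add_zero]

lemma mellin_upperPart (s : ℂ) :
    mellin (upperPart P) s = ∫ t in Ioi (1 : ℝ), (t : ℂ) ^ (s - 1) • (P.f t - P.f₀) := by
  simp only [mellin, upperPart, ← indicator_smul (Ioi (1 : ℝ)) fun t : ℝ => (t : ℂ) ^ (s - 1)]
  rw [setIntegral_indicator measurableSet_Ioi, inter_eq_right.2 (Ioi_subset_Ioi zero_le_one)]

lemma mellinConvergent_upperPart (s : ℂ) : MellinConvergent (upperPart P) s := by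
  have hconv : MellinConvergent P.f_modif s := (P.isStrongFEPair_toStrongFEPair.hasMellin s).1
  rw [MellinConvergent, upperPart_eq_indicator_f_modif]
  simpa only [indicator_smul] using IntegrableOn.indicator hconv measurableSet_Ioi

lemma Λ₀_eq_integral_add (s : ℂ) :
    P.Λ₀ s = (∫ t in Ioi (1 : ℝ), (t : ℂ) ^ (s - 1) • (P.f t - P.f₀)) +
      P.ε • ∫ t in Ioi (1 : ℝ), (t : ℂ) ^ (P.k - s - 1) • (P.g t - P.g₀) := by
  have hinv : MellinConvergent
      (fun t => (t : ℂ) ^ (-(P.k : ℂ)) • P.ε • upperPart P.symm t⁻¹) s := by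
    rw [MellinConvergent.cpow_smul]
    simp_rw [← Real.rpow_neg_one]
    rw [MellinConvergent.comp_rpow (f := fun t => P.ε • upperPart P.symm t) (by norm_num)]
    exact (mellinConvergent_upperPart P.symm _).const_smul _
  have hsplit : mellin P.f_modif s = mellin (fun t => upperPart P t +
      (t : ℂ) ^ (-(P.k : ℂ)) • P.ε • upperPart P.symm t⁻¹) s :=
    setIntegral_congr_fun measurableSet_Ioi fun t ht => by
      simp only [f_modif_eq_upperPart_add P ht]
  rw [WeakFEPair.Λ₀, hsplit, (hasMellin_add (mellinConvergent_upperPart P s) hinv).2,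
    mellin_cpow_smul, mellin_comp_inv (fun t => P.ε • upperPart P.symm t), mellin_const_smul,
    mellin_upperPart, mellin_upperPart]
  have hexp : -(s + -(P.k : ℂ)) - 1 = P.k - s - 1 := by ring
  rw [hexp]
  rfl

end FunctionalEquationPair

section MellinOfTheta

/-- The pair of theta series whose Mellin transform gives the completed Eisenstein series. -/
def thetaPair (b c : ℕ) (hbc : b = 0 ∨ c = 0) (hev : Even (b + c)) {z : ℂ} (hz : 0 < z.im) :
    WeakFEPair ℂ where
  f t := theta b c t z
  g t := theta b c t z
  k := (b + c : ℕ) + 1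
  ε := 1
  f₀ := 0 ^ (b + c)
  g₀ := 0 ^ (b + c)
  hf_int := ContinuousOn.locallyIntegrableOn (fun _ ht =>
    (hasDerivAt_theta b c hz ht).continuousAt.continuousWithinAt) measurableSet_Ioi
  hg_int := ContinuousOn.locallyIntegrableOn (fun _ ht =>
    (hasDerivAt_theta b c hz ht).continuousAt.continuousWithinAt) measurableSet_Ioi
  hk := by positivity
  hε := one_ne_zero
  h_feq t ht := by
    rw [theta_one_div ht hbc hev hz, one_mul, smul_eq_mul, ← Nat.cast_add_one,
      Real.rpow_natCast, Complex.ofReal_pow]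
  hf_top r := by simpa [theta] using isBigO_latSum_gauss b c hz r
  hg_top r := by simpa [theta] using isBigO_latSum_gauss b c hz r

/-- The kernel `t ^ (s - 1) + t ^ (a - s)`, symmetric under `s ↦ a + 1 - s`. -/
def mellinKernel (a : ℕ) (s : ℂ) (t : ℝ) : ℂ := (t : ℂ) ^ (s - 1) + (t : ℂ) ^ ((a : ℂ) - s)

lemma mellinKernel_symm (a : ℕ) (s : ℂ) : mellinKernel a (a + 1 - s) = mellinKernel a s := by
  ext t
  rw [mellinKernel, mellinKernel, add_comm]
  congr 2 <;> ring

lemma polyGrowth_mellinKernel (a : ℕ) (s : ℂ) : PolyGrowth (mellinKernel a s) :=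
  (polyGrowth_cpow _).add (polyGrowth_cpow _)

/-- The Mellin transform of a theta series with its two simple poles removed: the integral
against `t ^ (s - 1)` over `(0, ∞)` is folded to `(1, ∞)` by the transformation law. -/
def entirePart (b c : ℕ) (z s : ℂ) : ℂ := latSum b c (lap (mellinKernel (b + c) s)) z

lemma entirePart_symm (b c : ℕ) (z s : ℂ) :
    entirePart b c z ((b + c : ℕ) + 1 - s) = entirePart b c z s := by
  rw [entirePart, mellinKernel_symm, entirePart]

variable {b c : ℕ} (hbc : b = 0 ∨ c = 0) (hev : Even (b + c)) {z : ℂ} (hz : 0 < z.im)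

lemma thetaPair_Λ₀ (s : ℂ) : (thetaPair b c hbc hev hz).Λ₀ s = entirePart b c z s := by
  have hcpow (w : ℂ) := polyGrowth_cpow w
  have hlap : ∀ q > 0, lap (mellinKernel (b + c) s) q =
      lap (fun t => (t : ℂ) ^ (s - 1)) q + lap (fun t => (t : ℂ) ^ (((b + c : ℕ) : ℂ) - s)) q :=
    fun q hq => lap_add (hcpow _) (hcpow _) hq
  rw [Λ₀_eq_integral_add, entirePart, latSum_congr hlap b c hz,
    latSum_add (rapidDecay_lap (hcpow _)) (rapidDecay_lap (hcpow _)) b c hz,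
    ← integral_mul_latSum_gauss (hcpow _) b c hz, ← integral_mul_latSum_gauss (hcpow _) b c hz]
  have hexp : ((((b + c : ℕ) + 1 : ℝ) : ℂ) - s - 1) = ((b + c : ℕ) : ℂ) - s := by
    push_cast
    ring
  simp only [thetaPair, theta, add_sub_cancel_left, smul_eq_mul, one_mul, hexp]

include hbc hev hz in
lemma differentiable_entirePart : Differentiable ℂ (entirePart b c z) := by
  have hΛ₀ : (thetaPair b c hbc hev hz).Λ₀ = entirePart b c z := funext (thetaPair_Λ₀ hbc hev hz)
  exact hΛ₀ ▸ (thetaPair b c hbc hev hz).differentiable_Λ₀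

lemma mellin_latSum_gauss {s : ℂ} (hs : 1 + ((b + c : ℕ) : ℝ) / 2 < s.re) :
    mellin (fun t => latSum b c (gauss t) z) s = (thetaPair b c hbc hev hz).Λ s := by
  set P := thetaPair b c hbc hev hz with hP
  have hf : (fun t => latSum b c (gauss t) z) = (P.f · - P.f₀) := by
    ext t
    simp [hP, thetaPair, theta]
  rw [hf]
  rcases Nat.eq_zero_or_pos (b + c) with hzero | hpos
  · refine (P.hasMellin ?_).2
    simpa [hP, thetaPair, hzero] using hs
  · have hstrong : IsStrongFEPair P :=
      ⟨zero_pow hpos.ne', zero_pow hpos.ne'⟩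
    simp only [hstrong.hf₀, sub_zero]
    exact (hstrong.hasMellin s).2

include hbc hev hz in
lemma hasSum_entirePart {s : ℂ} (hs : 1 + ((b + c : ℕ) : ℝ) / 2 < s.re) :
    HasSum (fun p : Pairs => (Real.pi : ℂ) ^ (-s) * Complex.Gamma s *
        (lin p z ^ b * conj (lin p z) ^ c) / (quad p z : ℂ) ^ s)
      (entirePart b c z s - 0 ^ (b + c) / s - 0 ^ (b + c) / ((b + c : ℕ) + 1 - s)) := by
  have hre : 0 < s.re := by linarith [(b + c : ℕ).cast_nonneg (α := ℝ)]
  have hdecay : Decays (fun q : ℝ => ((q ^ (-s.re) : ℝ) : ℂ)) s.re :=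
    Decays.ofReal fun q₀ _ => isBigO_refl _ _
  have hmellin := hasSum_mellin_pi_mul
    (a := fun p : Pairs => lin p z ^ b * conj (lin p z) ^ c) (q := fun p => quad p z)
    (F := fun t => latSum b c (gauss t) z) (s := s) (fun p => .inr (quad_pos p hz)) hre
    (fun t ht => ((rapidDecay_gauss ht).hasSum_latTerm b c hz).congr_fun fun p => ?_)
    ((summable_latTerm hdecay (b := b) (c := c) (by linarith) hz).congr fun p => ?_)
  · have hΛ := mellin_latSum_gauss hbc hev hz hs
    rw [WeakFEPair.Λ, thetaPair_Λ₀] at hΛ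
    rw [hΛ] at hmellin
    convert hmellin using 1
    simp [thetaPair, div_eq_mul_inv, mul_comm]
  · have hexp : -(Real.pi * t) * quad p z = -Real.pi * quad p z * t := by ring
    rw [latTerm, gauss, smul_eq_mul, hexp]
  · have hq := quad_pos p hz
    rw [latTerm, norm_smul, Complex.norm_real, Real.norm_of_nonneg (by positivity),
      Real.rpow_neg hq.le, div_eq_mul_inv]

end MellinOfTheta

section Continuation

/-- The entire continuation in `s` of the doubly completed Eisenstein series of weight `-a`. -/
def eisNonpos (a : ℕ) (z s : ℂ) : ℂ :=
  (s - a / 2) * (s - a / 2 - 1) * (1 / 2 * (Real.pi : ℂ) ^ ((a : ℂ) / 2) * entirePart a 0 z s) +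
    1 / 2 * 0 ^ a

/-- The entire continuation in `s` of the doubly completed Eisenstein series of weight `k > 0`. -/
def eisPos (k : ℕ) (z s : ℂ) : ℂ :=
  (s + k / 2) * (s + k / 2 - 1) * (1 / 2 * (Real.pi : ℂ) ^ ((k : ℂ) / 2) *
    (((z.im : ℂ) ^ k)⁻¹ * entirePart 0 k z (s + k)))

lemma differentiable_eisNonpos {a : ℕ} (ha : Even a) {z : ℂ} (hz : 0 < z.im) :
    Differentiable ℂ (eisNonpos a z) := by
  have hent : Differentiable ℂ (entirePart a 0 z) :=
    differentiable_entirePart (.inr rfl) (by rwa [add_zero]) hz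
  unfold eisNonpos
  fun_prop

lemma differentiable_eisPos {k : ℕ} (hk : Even k) {z : ℂ} (hz : 0 < z.im) :
    Differentiable ℂ (eisPos k z) := by
  have hent : Differentiable ℂ (entirePart 0 k z) :=
    differentiable_entirePart (.inl rfl) (by rwa [zero_add]) hz
  unfold eisPos
  fun_prop

lemma eisPos_symm (k : ℕ) (z s : ℂ) : eisPos k z (1 - k - s) = eisPos k z s := by
  have hsymm := entirePart_symm 0 k z (s + k)
  have harg : (1 - k - s + k : ℂ) = ((0 + k : ℕ) : ℂ) + 1 - (s + k) := by
    push_cast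
    ring
  rw [eisPos, harg, hsymm, eisPos]
  ring

lemma norm_lin_cpow (p : ℤ × ℤ) {z : ℂ} (hz : 0 < z.im) (s : ℂ) :
    ((‖lin p z‖ : ℝ) : ℂ) ^ (2 * s) = (z.im : ℂ) ^ s * (quad p z : ℂ) ^ s := by
  have hq : 0 ≤ quad p z := div_nonneg (Complex.normSq_nonneg _) hz.le
  have hnorm : ‖lin p z‖ ^ 2 = z.im * quad p z := by
    rw [quad, Complex.normSq_eq_norm_sq, mul_div_cancel₀ _ hz.ne']
  have htwo : ((‖lin p z‖ : ℝ) : ℂ) ^ (2 * s) = ((‖lin p z‖ ^ 2 : ℝ) : ℂ) ^ s := by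
    rw [sq, Complex.ofReal_mul, Complex.mul_cpow_ofReal_nonneg (norm_nonneg _) (norm_nonneg _),
      Complex.cpow_ofNat_mul, sq]
  rw [htwo, hnorm, Complex.ofReal_mul, Complex.mul_cpow_ofReal_nonneg hz.le hq]

lemma eisSeries_eq_tsum (k : ℤ) (z : ℍ) (s : ℂ) :
    eisSeries k z s = 1 / 2 * ∑' p : Pairs, (lin p z ^ k * (quad p z : ℂ) ^ s)⁻¹ := by
  have hy : (z.im : ℂ) ^ s ≠ 0 := by
    rw [Ne, Complex.cpow_eq_zero_iff]
    exact fun h => Complex.ofReal_ne_zero.2 z.im_ne_zero h.1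
  rw [eisSeries]
  congr 1
  refine tsum_congr fun p => ?_
  change (z.im : ℂ) ^ s / (lin p z ^ k * ((‖lin p z‖ : ℝ) : ℂ) ^ (2 * s)) = _
  rw [norm_lin_cpow _ z.im_pos, mul_left_comm, ← div_div, UpperHalfPlane.coe_im, div_self hy,
    one_div]

lemma pi_cpow_add (u v : ℂ) : (Real.pi : ℂ) ^ (u + v) = (Real.pi : ℂ) ^ u * (Real.pi : ℂ) ^ v :=
  Complex.cpow_add _ _ (Complex.ofReal_ne_zero.2 Real.pi_ne_zero)

lemma completedSeries_neg {a : ℕ} (ha : Even a) (z : ℍ) {s : ℂ}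
    (hs : 1 + (a : ℝ) / 2 < s.re) :
    completedSeries (-(a : ℤ)) z s = 1 / 2 * (Real.pi : ℂ) ^ ((a : ℂ) / 2) *
      (entirePart a 0 z s - 0 ^ a / s - 0 ^ a / (a + 1 - s)) := by
  have hsum : HasSum _ (entirePart a 0 z s - 0 ^ a / s - 0 ^ a / (a + 1 - s)) :=
    hasSum_entirePart (b := a) (c := 0) (.inr rfl) (by rwa [add_zero]) z.im_pos hs
  have hgamma : s + ((-(a : ℤ) : ℤ) : ℂ) / 2 + ((|-(a : ℤ)| : ℤ) : ℂ) / 2 = s := by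
    rw [abs_neg, Nat.abs_cast]
    push_cast
    ring
  have hpow : -(s + ((-(a : ℤ) : ℤ) : ℂ) / 2) = a / 2 + -s := by
    push_cast
    ring
  rw [completedSeries, eisSeries_eq_tsum, hgamma, hpow, pi_cpow_add, ← hsum.tsum_eq,
    ← tsum_mul_left, ← tsum_mul_left, ← tsum_mul_left]
  refine tsum_congr fun p => ?_
  rw [zpow_neg, zpow_natCast, mul_inv, inv_inv, pow_zero]
  ring

lemma completedSeries_pos {k : ℕ} (hk : Even k) (hk0 : 0 < k) (z : ℍ) {s : ℂ}
    (hs : 1 - (k : ℝ) / 2 < s.re) :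
    completedSeries k z s = 1 / 2 * (Real.pi : ℂ) ^ ((k : ℂ) / 2) *
      (((z.im : ℂ) ^ k)⁻¹ * entirePart 0 k z (s + k)) := by
  have hsum := hasSum_entirePart (b := 0) (c := k) (.inl rfl) (by rwa [zero_add]) z.im_pos
    (s := s + k) (by rw [Complex.add_re, Complex.natCast_re, zero_add]; linarith)
  rw [zero_add, zero_pow hk0.ne', zero_div, zero_div, sub_zero, sub_zero] at hsum
  have hgamma : s + ((k : ℤ) : ℂ) / 2 + ((|(k : ℤ)| : ℤ) : ℂ) / 2 = s + k := by
    rw [Nat.abs_cast]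
    push_cast
    ring
  have hpow : -(s + ((k : ℤ) : ℂ) / 2) = k / 2 + -(s + k) := by
    push_cast
    ring
  rw [completedSeries, eisSeries_eq_tsum, hgamma, hpow, pi_cpow_add, ← hsum.tsum_eq,
    ← tsum_mul_left, ← tsum_mul_left, ← tsum_mul_left, ← tsum_mul_left]
  refine tsum_congr fun p => ?_
  have hlin : lin p z ≠ 0 := lin_ne_zero p z.im_pos
  have hconj : conj (lin p z) ≠ 0 := (map_ne_zero _).2 hlin
  have hy : (z.im : ℂ) ≠ 0 := Complex.ofReal_ne_zero.2 z.im_ne_zero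
  have hq : (quad p z : ℂ) ≠ 0 := Complex.ofReal_ne_zero.2 (quad_pos p z.im_pos).ne'
  have hquad : lin p z ^ k * conj (lin p z) ^ k = (z.im : ℂ) ^ k * (quad p z : ℂ) ^ k := by
    rw [← mul_pow, mul_conj_lin _ z.im_pos, mul_pow, UpperHalfPlane.coe_im]
  rw [Complex.cpow_add _ _ hq, Complex.cpow_natCast, zpow_natCast, pow_zero, one_mul]
  have hqs : (quad p z : ℂ) ^ s ≠ 0 := by rw [Ne, Complex.cpow_eq_zero_iff]; exact fun h => hq h.1
  field_simp
  linear_combination (-Complex.Gamma (s + k)) * hquad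

lemma eisNonpos_eq_series {a : ℕ} (ha : Even a) (z : ℍ) {s : ℂ} (hs : 1 + (a : ℝ) / 2 < s.re) :
    eisNonpos a z s = doublyCompletedSeries (-(a : ℤ)) z s := by
  rw [doublyCompletedSeries, completedSeries_neg ha z hs, eisNonpos]
  rcases Nat.eq_zero_or_pos a with rfl | hpos
  · rw [Nat.cast_zero, zero_div, add_zero] at hs
    have hs0 : s ≠ 0 := by
      rintro rfl
      exact hs.not_gt one_pos
    have hs1 : (1 : ℂ) - s ≠ 0 := sub_ne_zero.2 (by
      rintro rfl
      exact hs.ne Complex.one_re.symm)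
    push_cast
    rw [zero_div, Complex.cpow_zero]
    simp only [pow_zero, zero_add, neg_zero, zero_div, sub_zero, add_zero]
    field_simp
    ring
  · rw [zero_pow hpos.ne']
    push_cast
    ring

lemma eisPos_eq_series {k : ℕ} (hk : Even k) (hk0 : 0 < k) (z : ℍ) {s : ℂ}
    (hs : 1 - (k : ℝ) / 2 < s.re) : eisPos k z s = doublyCompletedSeries k z s := by
  rw [doublyCompletedSeries, completedSeries_pos hk hk0 z hs, eisPos, Int.cast_natCast,
    UpperHalfPlane.coe_im]

lemma IsEntireContinuation.unique {k : ℤ} {z : ℍ} {g h : ℂ → ℂ} (hg : IsEntireContinuation k z g)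
    (hh : IsEntireContinuation k z h) : g = h := by
  refine AnalyticOnNhd.eq_of_eventuallyEq (z₀ := ((2 - (k : ℝ) / 2 : ℝ) : ℂ))
    (fun s _ => hg.1.analyticAt s) (fun s _ => hh.1.analyticAt s) ?_
  have hre : 1 - (k : ℝ) / 2 < (((2 - (k : ℝ) / 2 : ℝ) : ℂ)).re := by
    rw [Complex.ofReal_re]
    linarith
  filter_upwards [Complex.continuous_re.continuousAt.eventually (lt_mem_nhds hre)] with s hs
  rw [hg.2 s hs, hh.2 s hs]

lemma IsEntireContinuation.doublyCompletedEis_eq {k : ℤ} {z : ℍ} {g : ℂ → ℂ}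
    (hg : IsEntireContinuation k z g) : doublyCompletedEis k z = g := by
  have hex : ∃ g : ℂ → ℂ, IsEntireContinuation k z g := ⟨g, hg⟩
  rw [doublyCompletedEis, dif_pos hex]
  exact hex.choose_spec.unique hg

lemma isEntireContinuation_eisNonpos {a : ℕ} (ha : Even a) (z : ℍ) :
    IsEntireContinuation (-(a : ℤ)) z (eisNonpos a z) :=
  ⟨differentiable_eisNonpos ha z.im_pos, fun s hs => eisNonpos_eq_series ha z (by
    push_cast at hs; linarith)⟩

lemma isEntireContinuation_eisPos {k : ℕ} (hk : Even k) (hk0 : 0 < k) (z : ℍ) :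
    IsEntireContinuation k z (eisPos k z) :=
  ⟨differentiable_eisPos hk z.im_pos, fun _ hs => eisPos_eq_series hk hk0 z hs⟩

end Continuation

section LaplaceRecurrences

variable {B : Type*} [NormedAddCommGroup B]

lemma lap_congr [NormedSpace ℝ B] {V W : ℝ → B} (h : ∀ t > 1, V t = W t) : lap V = lap W :=
  funext fun _ => setIntegral_congr_fun measurableSet_Ioi fun t ht => by simp only [h t ht]

lemma lap_const_smul [NormedSpace ℂ B] (a : ℂ) (W : ℝ → B) :
    lap (fun t => a • W t) = fun q => a • lap W q := by
  ext q
  simp only [lap, smul_comm _ a]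
  exact integral_smul _ _

lemma neg_pi_mul_smul_mellinKernel (a : ℕ) (s : ℂ) {t : ℝ} (ht : 0 < t) :
    (-(Real.pi * t)) • mellinKernel a s t =
      (-Real.pi : ℂ) • mellinKernel (a + 2) (s + 1) t := by
  have ht0 : (t : ℂ) ≠ 0 := Complex.ofReal_ne_zero.2 ht.ne'
  have hfst : s + 1 - 1 = s - 1 + 1 := by ring
  have hsnd : ((a + 2 : ℕ) : ℂ) - (s + 1) = a - s + 1 := by
    push_cast
    ring
  rw [mellinKernel, mellinKernel, hfst, hsnd, Complex.cpow_add _ _ ht0,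
    Complex.cpow_add _ _ ht0, Complex.cpow_one, Complex.real_smul, smul_eq_mul]
  push_cast
  ring

lemma hasDerivAt_neg_exp_mul_cpow (c : ℝ) (s : ℂ) {t : ℝ} (ht : 0 < t) :
    HasDerivAt (fun t : ℝ => -((Real.exp (-c * t) : ℝ) : ℂ) * (t : ℂ) ^ s)
      (c * (Real.exp (-c * t) • (t : ℂ) ^ s) -
        s * (Real.exp (-c * t) • (t : ℂ) ^ (s - 1))) t := by
  have hexp : HasDerivAt (fun t : ℝ => -((Real.exp (-c * t) : ℝ) : ℂ))
      (-((Real.exp (-c * t) * (-c * 1) : ℝ) : ℂ)) t :=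
    ((hasDerivAt_id t).const_mul (-c)).exp.ofReal_comp.neg
  have hpow : HasDerivAt (fun t : ℝ => (t : ℂ) ^ s) (s * (t : ℂ) ^ (s - 1) * 1) t :=
    ((hasDerivAt_id (t : ℂ)).cpow_const (Complex.ofReal_mem_slitPlane.2 ht)).comp_ofReal
  refine (hexp.mul hpow).congr_deriv ?_
  simp only [Complex.real_smul]
  push_cast
  ring

lemma tendsto_neg_exp_mul_cpow {c : ℝ} (hc : 0 < c) (s : ℂ) :
    Tendsto (fun t : ℝ => -((Real.exp (-c * t) : ℝ) : ℂ) * (t : ℂ) ^ s) atTop (𝓝 0) := by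
  rw [tendsto_zero_iff_norm_tendsto_zero]
  refine (tendsto_rpow_mul_exp_neg_mul_atTop_nhds_zero s.re _ hc).congr' ?_
  filter_upwards [eventually_gt_atTop 0] with t ht
  rw [norm_mul, norm_neg, Complex.norm_real, Real.norm_of_nonneg (Real.exp_pos _).le,
    Complex.norm_cpow_eq_rpow_re_of_pos ht, mul_comm]

lemma mul_lap_cpow (s : ℂ) {q : ℝ} (hq : 0 < q) :
    Real.pi * q * lap (fun t => (t : ℂ) ^ s) q =
      gauss 1 q + s * lap (fun t => (t : ℂ) ^ (s - 1)) q := by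
  have hpq : 0 < Real.pi * q := mul_pos Real.pi_pos hq
  have hint (w : ℂ) : IntegrableOn
      (fun t : ℝ => Real.exp (-(Real.pi * q) * t) • (t : ℂ) ^ w) (Ioi 1) :=
    (polyGrowth_cpow w).integrableOn hpq
  have hparts := integral_Ioi_of_hasDerivAt_of_tendsto
    (hasDerivAt_neg_exp_mul_cpow (Real.pi * q) s one_pos).continuousAt.continuousWithinAt
    (fun t ht => hasDerivAt_neg_exp_mul_cpow (Real.pi * q) s (one_pos.trans ht))
    (((hint _).const_mul _).sub ((hint _).const_mul _)) (tendsto_neg_exp_mul_cpow hpq s)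
  rw [integral_sub ((hint _).const_mul _) ((hint _).const_mul _), integral_const_mul,
    integral_const_mul, Complex.ofReal_one, Complex.one_cpow, Complex.ofReal_mul] at hparts
  have hgauss : gauss 1 q = ((Real.exp (-(Real.pi * q) * 1) : ℝ) : ℂ) := by
    rw [gauss, mul_one, mul_one, neg_mul]
  rw [lap, lap, hgauss]
  linear_combination hparts

lemma lap_mellinKernel (a : ℕ) (s : ℂ) {q : ℝ} (hq : 0 < q) :
    lap (mellinKernel a s) q =
      lap (fun t => (t : ℂ) ^ (s - 1)) q + lap (fun t => (t : ℂ) ^ ((a : ℂ) - s)) q :=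
  lap_add (polyGrowth_cpow _) (polyGrowth_cpow _) hq

/- The profile of `∂/∂z̄ (y ^ (-(a + 2)) * entirePart 0 (a + 2) z s)` is, up to a Gaussian, the
profile of an `entirePart` of index `a`; the Gaussian is later summed by
`two_pi_mul_latSum_gauss_one`. -/
lemma lap_mellinKernel_recurrence (a : ℕ) (s : ℂ) {q : ℝ} (hq : 0 < q) :
    (a + 2) * (q * lap (mellinKernel (a + 2) s) q) -
        Real.pi * (q * (q * lap (mellinKernel (a + 4) (s + 1)) q)) =
      (a + 2 - s) * (s - 1) / Real.pi * lap (mellinKernel a (s - 1)) q +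
        ((a + 1) / Real.pi * gauss 1 q - 2 * (q * gauss 1 q)) := by
  have hpi : (Real.pi : ℂ) ≠ 0 := Complex.ofReal_ne_zero.2 Real.pi_ne_zero
  have hrec₁ := mul_lap_cpow (s - 1) hq
  have hrec₂ := mul_lap_cpow (a + 2 - s) hq
  have hrec₃ := mul_lap_cpow s hq
  have hrec₄ := mul_lap_cpow (a + 3 - s) hq
  rw [show (a + 2 - s - 1 : ℂ) = a - (s - 1) by ring] at hrec₂
  rw [show (a + 3 - s - 1 : ℂ) = a + 2 - s by ring] at hrec₄
  rw [lap_mellinKernel _ _ hq, lap_mellinKernel _ _ hq, lap_mellinKernel _ _ hq]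
  push_cast
  rw [add_sub_cancel_right, show (a + 4 - (s + 1) : ℂ) = a + 3 - s by ring]
  field_simp
  linear_combination (a + 2 - s) * hrec₁ + (s - 1) * hrec₂ - Real.pi * q * hrec₃ -
    Real.pi * q * hrec₄

end LaplaceRecurrences

section RampOfEntirePart

lemma dbarC_mul {f g : ℂ → ℂ} {z : ℂ} (hf : DifferentiableAt ℝ f z)
    (hg : DifferentiableAt ℝ g z) :
    dbarC (fun w => f w * g w) z = dbarC f z * g z + f z * dbarC g z := by
  rw [dbarC, fderiv_fun_mul hf hg]
  simp only [dbarC, add_apply, smul_apply, smul_eq_mul]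
  ring

lemma hasFDerivAt_im_pow_inv (k : ℕ) {z : ℂ} (hz : 0 < z.im) :
    HasFDerivAt (fun w : ℂ => ((w.im : ℂ) ^ k)⁻¹)
      (wirtingerL ℂ (k * ((z.im : ℂ) ^ (k + 1))⁻¹ * (Complex.I / 2),
        -(k * ((z.im : ℂ) ^ (k + 1))⁻¹ * (Complex.I / 2)))) z := by
  have hy : (z.im : ℂ) ≠ 0 := Complex.ofReal_ne_zero.2 hz.ne'
  have h := (hasDerivAt_inv (pow_ne_zero k hy)).comp_hasFDerivAt z ((hasFDerivAt_im z).pow k)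
  refine HasFDerivAt.congr_fderiv h ?_
  ext w
  rcases k with _ | k
  · simp [wirtingerL_apply]
  · simp only [wirtingerL_apply, smul_apply, smul_eq_mul, Nat.add_sub_cancel, nsmul_eq_mul]
    field_simp
    ring

lemma latSum_succ_succ (b c : ℕ) (E : ℝ → ℂ) {z : ℂ} (hz : 0 < z.im) :
    latSum (b + 1) (c + 1) E z = z.im * latSum b c (fun q => q * E q) z := by
  rw [latSum, latSum, ← tsum_mul_left]
  refine tsum_congr fun p => ?_
  simp only [latTerm, smul_eq_mul]
  linear_combination (lin p z ^ b * conj (lin p z) ^ c * E (quad p z)) * mul_conj_lin p hz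

lemma differentiableAt_entirePart (b c : ℕ) (s : ℂ) {z : ℂ} (hz : 0 < z.im) :
    DifferentiableAt ℝ (fun w => entirePart b c w s) z :=
  (hasFDerivAt_latSum_lap (polyGrowth_mellinKernel _ _) b c hz).differentiableAt

lemma dbarC_entirePart (b c : ℕ) (s : ℂ) {z : ℂ} (hz : 0 < z.im) :
    dbarC (fun w => entirePart b c w s) z =
      ((c : ℂ) / (2 * Complex.I * z.im)) *
          (latSum (b + 1) (c - 1) (lap (mellinKernel (b + c) s)) z - entirePart b c z s) +
        (Complex.I / (2 * (z.im : ℂ) ^ 2)) * (Real.pi * entirePart (b + 2) c z (s + 1)) := by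
  have hkernel : lap (fun t => (-(Real.pi * t)) • mellinKernel (b + c) s t) =
      fun q => (-Real.pi : ℂ) • lap (mellinKernel (b + 2 + c) (s + 1)) q := by
    rw [← lap_const_smul, add_right_comm]
    exact lap_congr fun t ht => neg_pi_mul_smul_mellinKernel _ s (one_pos.trans ht)
  have hdbar := dbarC_of_hasFDerivAt
    (hasFDerivAt_latSum_lap (polyGrowth_mellinKernel (b + c) s) b c hz)
  rw [hkernel] at hdbar
  simp only [latDeriv, latSum_const_smul] at hdbar
  simp only [smul_eq_mul] at hdbar
  exact hdbar.trans (by simp only [entirePart]; ring)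

lemma conj_mellinKernel (a : ℕ) (s : ℂ) {t : ℝ} (ht : 0 < t) :
    conj (mellinKernel a s t) = mellinKernel a (conj s) t := by
  have hcpow (w : ℂ) : conj ((t : ℂ) ^ w) = (t : ℂ) ^ conj w := by
    have harg : (t : ℂ).arg ≠ Real.pi :=
      Complex.arg_ofReal_of_nonneg ht.le ▸ Real.pi_pos.ne
    rw [Complex.cpow_conj _ _ harg, Complex.conj_ofReal]
  simp only [mellinKernel, map_add, hcpow, map_sub, map_one, Complex.conj_natCast]

lemma conj_entirePart (b c : ℕ) (z s : ℂ) :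
    conj (entirePart b c z s) = entirePart c b z (conj s) := by
  rw [entirePart, latSum_conj, entirePart, add_comm c b]
  congr 1
  ext q
  rw [lap, ← integral_conj]
  refine setIntegral_congr_fun measurableSet_Ioi fun t ht => ?_
  simp only [Complex.real_smul, map_mul, Complex.conj_ofReal,
    conj_mellinKernel _ _ (one_pos.trans ht)]

lemma latSum_mellinKernel_recurrence {a : ℕ} (ha : Even a) (s : ℂ) {z : ℂ} (hz : 0 < z.im) :
    (a + 2) * latSum 0 a (fun q => q * lap (mellinKernel (a + 2) s) q) z -
        Real.pi * latSum 0 a (fun q => q * (q * lap (mellinKernel (a + 4) (s + 1)) q)) z =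
      (a + 2 - s) * (s - 1) / Real.pi * entirePart 0 a z (s - 1) -
        (a + 1) / Real.pi * 0 ^ a := by
  have hpi : (Real.pi : ℂ) ≠ 0 := Complex.ofReal_ne_zero.2 Real.pi_ne_zero
  have hlap (j : ℕ) (w : ℂ) : RapidDecay (lap (mellinKernel j w)) :=
    rapidDecay_lap (polyGrowth_mellinKernel j w)
  have hgauss : RapidDecay (gauss 1) := rapidDecay_gauss one_pos
  have hprofile : ∀ q : ℝ, q > 0 →
      (a + 2 : ℂ) • ((q : ℂ) • lap (mellinKernel (a + 2) s) q) +
          (2 : ℂ) • ((q : ℂ) • gauss 1 q) =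
        (((a + 2 - s) * (s - 1) / Real.pi : ℂ) • lap (mellinKernel a (s - 1)) q +
          ((a + 1) / Real.pi : ℂ) • gauss 1 q) +
          (Real.pi : ℂ) • ((q : ℂ) • ((q : ℂ) • lap (mellinKernel (a + 4) (s + 1)) q)) := by
    intro q hq
    simp only [smul_eq_mul]
    linear_combination lap_mellinKernel_recurrence a s hq
  have hsum := latSum_congr hprofile 0 a hz
  rw [latSum_add ((hlap _ _).mul_id.const_smul _) (hgauss.mul_id.const_smul _) 0 a hz,
    latSum_add (((hlap _ _).const_smul _).add (hgauss.const_smul _))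
      ((hlap _ _).mul_id.mul_id.const_smul _) 0 a hz,
    latSum_add ((hlap _ _).const_smul _) (hgauss.const_smul _) 0 a hz] at hsum
  simp only [latSum_const_smul] at hsum
  simp only [smul_eq_mul] at hsum
  have hinv := two_pi_mul_latSum_gauss_one (b := 0) (c := a) (.inl rfl) (by rwa [zero_add]) hz
  simp only [smul_eq_mul, theta, zero_add] at hinv
  rw [entirePart, zero_add]
  field_simp at hsum ⊢
  linear_combination hsum - hinv

lemma dbarC_im_pow_inv_mul_entirePart {a : ℕ} (ha : Even a) (s : ℂ) {z : ℂ} (hz : 0 < z.im) :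
    dbarC (fun w => ((w.im : ℂ) ^ (a + 2))⁻¹ * entirePart 0 (a + 2) w s) z =
      -(Complex.I / 2) * ((z.im : ℂ) ^ (a + 2))⁻¹ *
        ((a + 2 - s) * (s - 1) / Real.pi * entirePart 0 a z (s - 1) -
          (a + 1) / Real.pi * 0 ^ a) := by
  have hy : (z.im : ℂ) ≠ 0 := Complex.ofReal_ne_zero.2 hz.ne'
  have hI := Complex.I_ne_zero
  have him := hasFDerivAt_im_pow_inv (a + 2) hz
  have hfirst : latSum 1 (a + 1) (lap (mellinKernel (a + 2) s)) z =
      z.im * latSum 0 a (fun q => q * lap (mellinKernel (a + 2) s) q) z :=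
    latSum_succ_succ _ _ _ hz
  have hsecond : entirePart 2 (a + 2) z (s + 1) = z.im * (z.im *
      latSum 0 a (fun q => q * (q * lap (mellinKernel (a + 4) (s + 1)) q)) z) := by
    have hindex : 2 + (a + 2) = a + 4 := by ring
    rw [entirePart, hindex, latSum_succ_succ _ _ _ hz, latSum_succ_succ _ _ _ hz]
  rw [dbarC_mul him.differentiableAt (differentiableAt_entirePart _ _ _ hz),
    dbarC_of_hasFDerivAt him, dbarC_entirePart _ _ _ hz, ← latSum_mellinKernel_recurrence ha s hz]
  simp only [zero_add, Nat.add_succ_sub_one]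
  rw [hfirst, hsecond]
  push_cast
  have hinv : (2 * Complex.I * z.im)⁻¹ = -(Complex.I / 2) * (z.im : ℂ)⁻¹ := by
    rw [mul_inv, mul_inv, Complex.inv_I]
    ring
  rw [div_eq_mul_inv ((a : ℂ) + 2), hinv]
  field_simp
  ring

end RampOfEntirePart

section Ramp

lemma conj_pi_cpow_half (a : ℕ) :
    conj ((Real.pi : ℂ) ^ ((a : ℂ) / 2)) = (Real.pi : ℂ) ^ ((a : ℂ) / 2) := by
  have hreal : (a : ℂ) / 2 = (((a : ℝ) / 2 : ℝ) : ℂ) := by push_cast; rfl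
  rw [hreal, ← Complex.ofReal_cpow Real.pi_pos.le, Complex.conj_ofReal]

lemma pi_cpow_half_add_two (a : ℕ) :
    (Real.pi : ℂ) ^ (((a + 2 : ℕ) : ℂ) / 2) = (Real.pi : ℂ) ^ ((a : ℂ) / 2) * Real.pi := by
  have hexp : ((a + 2 : ℕ) : ℂ) / 2 = a / 2 + 1 := by
    push_cast
    ring
  rw [hexp, pi_cpow_add, Complex.cpow_one]

lemma dbarC_eisNonpos (a : ℕ) (s : ℂ) {z : ℂ} (hz : 0 < z.im) :
    dbarC (fun w => eisNonpos a w s) z =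
      Complex.I / 2 * (z.im : ℂ) ^ a * conj (eisPos (a + 2) z (-conj s)) := by
  have hy : (z.im : ℂ) ≠ 0 := Complex.ofReal_ne_zero.2 hz.ne'
  have hd := differentiableAt_entirePart a 0 s hz
  have hscaled : dbarC (fun w => eisNonpos a w s) z =
      ((s - a / 2) * (s - a / 2 - 1) * (1 / 2 * (Real.pi : ℂ) ^ ((a : ℂ) / 2))) *
        dbarC (fun w => entirePart a 0 w s) z := by
    rw [← smul_eq_mul, ← dbarC_const_smul hd, ← add_zero (dbarC (fun w => _ • _) z),
      ← dbarC_const (1 / 2 * 0 ^ a : ℂ) z,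
      ← dbarC_add (hd.fun_const_smul (_ : ℂ)) (differentiableAt_const _)]
    congr 1
    ext w
    rw [eisNonpos, smul_eq_mul]
    ring
  have harg : 1 - ((a + 2 : ℕ) : ℂ) - -conj s + ((a + 2 : ℕ) : ℂ) = conj (s + 1) := by
    rw [map_add, map_one]
    ring
  rw [hscaled, dbarC_entirePart _ _ _ hz, ← eisPos_symm, eisPos, harg, ← conj_entirePart (a + 2) 0]
  simp only [map_mul, map_add, map_sub, map_neg, map_one, map_div₀, map_inv₀, map_pow,
    Complex.conj_conj, Complex.conj_ofReal, Complex.conj_natCast, map_ofNat, conj_pi_cpow_half,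
    pi_cpow_half_add_two]
  push_cast
  field_simp
  ring

lemma dbarC_eisPos {a : ℕ} (ha : Even a) (s : ℂ) {z : ℂ} (hz : 0 < z.im) :
    dbarC (fun w => eisPos (a + 2) w s) z =
      Complex.I / 2 * ((z.im : ℂ) ^ (a + 2))⁻¹ *
        (s * (s + (a + 1)) * conj (eisNonpos a z (-conj s))) := by
  have hpi : (Real.pi : ℂ) ≠ 0 := Complex.ofReal_ne_zero.2 Real.pi_ne_zero
  have hy : (z.im : ℂ) ≠ 0 := Complex.ofReal_ne_zero.2 hz.ne'
  have hscaled : dbarC (fun w => eisPos (a + 2) w s) z =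
      ((s + (a + 2 : ℕ) / 2) * (s + (a + 2 : ℕ) / 2 - 1) *
        (1 / 2 * (Real.pi : ℂ) ^ (((a + 2 : ℕ) : ℂ) / 2))) *
        dbarC (fun w : ℂ => ((w.im : ℂ) ^ (a + 2))⁻¹ *
          entirePart 0 (a + 2) w (s + (a + 2 : ℕ))) z := by
    rw [← smul_eq_mul, ← dbarC_const_smul
      ((hasFDerivAt_im_pow_inv (a + 2) hz).differentiableAt.fun_mul
        (differentiableAt_entirePart _ _ _ hz))]
    congr 1
    ext w
    rw [eisPos, smul_eq_mul]
    ring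
  have hsymm : entirePart 0 a z (s + (a + 2 : ℕ) - 1) = entirePart 0 a z (-s) := by
    rw [← entirePart_symm]
    congr 1
    push_cast
    ring
  rw [hscaled, dbarC_im_pow_inv_mul_entirePart ha _ hz, hsymm, eisNonpos]
  simp only [map_mul, map_add, map_sub, map_neg, map_one, map_div₀, map_pow, map_zero,
    Complex.conj_conj, Complex.conj_natCast, map_ofNat, conj_pi_cpow_half, pi_cpow_half_add_two,
    conj_entirePart]
  -- the constant term survives only in weight `0`
  rcases Nat.eq_zero_or_pos a with rfl | hpos
  · rw [Nat.cast_zero, zero_div, Complex.cpow_zero]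
    simp only [pow_zero]
    push_cast
    field_simp
    ring
  · rw [zero_pow hpos.ne']
    push_cast
    field_simp
    ring

end Ramp

section Taylor

/-- The `n`-th Taylor coefficient of `f` at `0`. -/
def taylorAt (f : ℂ → ℂ) (n : ℕ) : ℂ := iteratedDeriv n f 0 / (n.factorial : ℂ)

lemma hasSum_taylorAt {f : ℂ → ℂ} (hf : Differentiable ℂ f) (s : ℂ) :
    HasSum (fun n => taylorAt f n * s ^ n) (f s) := by
  refine (Complex.hasSum_taylorSeries_of_entire hf 0 s).congr_fun fun n => ?_
  rw [taylorAt, smul_eq_mul, smul_eq_mul, sub_zero]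
  ring

lemma taylorAt_eq_of_hasSum {f : ℂ → ℂ} (hf : Differentiable ℂ f) {a : ℕ → ℂ}
    (ha : ∀ s, HasSum (fun n => a n * s ^ n) (f s)) (n : ℕ) : taylorAt f n = a n := by
  have hasFPowerSeries (b : ℕ → ℂ) (hb : ∀ s, HasSum (fun n => b n * s ^ n) (f s)) :
      HasFPowerSeriesAt f (FormalMultilinearSeries.ofScalars ℂ b) 0 := by
    rw [hasFPowerSeriesAt_iff]
    refine .of_forall fun s => ?_
    simpa only [FormalMultilinearSeries.coeff_ofScalars, smul_eq_mul, mul_comm, zero_add]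
      using hb s
  have h := (hasFPowerSeries _ (hasSum_taylorAt hf)).eq_formalMultilinearSeries
    (hasFPowerSeries a ha)
  simpa only [FormalMultilinearSeries.coeff_ofScalars] using
    congrArg (fun p => FormalMultilinearSeries.coeff p n) h

/-- The `n`-th Fourier coefficient of a continuous function on the unit circle, as a continuous
linear functional for the supremum norm. -/
def circleCoeff (n : ℕ) : C(Circle, ℂ) →L[ℂ] ℂ :=
  LinearMap.mkContinuous
    { toFun := fun φ => (2 * Real.pi : ℂ)⁻¹ *
        ∫ θ in (0 : ℝ)..2 * Real.pi, (Circle.exp θ : ℂ)⁻¹ ^ n * φ (Circle.exp θ)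
      map_add' := fun φ ψ => by
        simp only [ContinuousMap.add_apply, mul_add]
        rw [intervalIntegral.integral_add, mul_add] <;>
          exact Continuous.intervalIntegrable (by fun_prop (disch := simp)) _ _
      map_smul' := fun r φ => by
        simp only [ContinuousMap.smul_apply, smul_eq_mul, RingHom.id_apply, mul_left_comm _ r,
          intervalIntegral.integral_const_mul] }
    1 fun φ => by
      have h := intervalIntegral.norm_integral_le_of_norm_le_const (a := (0 : ℝ))
        (b := 2 * Real.pi) (C := ‖φ‖)
        (f := fun θ => (Circle.exp θ : ℂ)⁻¹ ^ n * φ (Circle.exp θ)) fun θ _ => by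
          simpa only [norm_mul, norm_pow, norm_inv, Circle.norm_coe, inv_one, one_pow, one_mul]
            using φ.norm_coe_le_norm (Circle.exp θ)
      rw [sub_zero, abs_of_pos Real.two_pi_pos] at h
      simp only [LinearMap.coe_mk, AddHom.coe_mk, norm_mul, norm_inv, one_mul]
      rw [Complex.norm_ofNat, Complex.norm_real, Real.norm_of_nonneg Real.pi_pos.le,
        inv_mul_le_iff₀ Real.two_pi_pos, mul_comm _ ‖φ‖]
      exact h

lemma circleCoeff_eq_taylorAt {f : ℂ → ℂ} (hf : Differentiable ℂ f) (n : ℕ) {φ : C(Circle, ℂ)}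
    (hφ : ∀ ζ : Circle, φ ζ = f ζ) : circleCoeff n φ = taylorAt f n := by
  have hcauchy := hf.diffContOnCl.circleIntegral_one_div_sub_center_pow_smul (c := 0) one_pos n
  have hcircle : ∮ z in C(0, 1), (1 / (z - 0) ^ (n + 1)) • f z = Complex.I *
      ∫ θ in (0 : ℝ)..2 * Real.pi, (Circle.exp θ : ℂ)⁻¹ ^ n * φ (Circle.exp θ) := by
    rw [circleIntegral, ← intervalIntegral.integral_const_mul]
    refine intervalIntegral.integral_congr fun θ _ => ?_
    have hθ : (Circle.exp θ : ℂ) ≠ 0 := Circle.coe_ne_zero _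
    have hmap : circleMap 0 1 θ = Circle.exp θ := by
      rw [circleMap_zero, Circle.coe_exp, Complex.ofReal_one, one_mul]
    simp only [deriv_circleMap, hmap, hφ, smul_eq_mul, sub_zero]
    rw [one_div, pow_succ, mul_inv, inv_pow]
    field_simp
  rw [hcircle, smul_eq_mul] at hcauchy
  change (2 * Real.pi : ℂ)⁻¹ * _ = _
  rw [taylorAt, inv_mul_eq_iff_eq_mul₀ (by simp)]
  refine mul_left_cancel₀ Complex.I_ne_zero (hcauchy.trans ?_)
  ring

/-- A family `z ↦ H z` of entire functions, parametrised by the upper half-plane, whose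
restrictions to the unit circle depend smoothly on `z` in the supremum norm. Cauchy's formula then
makes the Taylor coefficients of `H z` at `0` smooth in `z`. -/
structure SmoothEntireFamily (H : ℂ → ℂ → ℂ) : Prop where
  differentiable : ∀ z, 0 < z.im → Differentiable ℂ (H z)
  exists_circle_lift : ∃ Φ : ℂ → C(Circle, ℂ), ContDiffOn ℝ ∞ Φ {z : ℂ | 0 < z.im} ∧
    ∀ z, 0 < z.im → ∀ ζ : Circle, Φ z ζ = H z ζ

namespace SmoothEntireFamily

variable {H : ℂ → ℂ → ℂ}

lemma contDiffOn_taylorAt (hH : SmoothEntireFamily H) (n : ℕ) :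
    ContDiffOn ℝ ∞ (fun z => taylorAt (H z) n) {z : ℂ | 0 < z.im} := by
  obtain ⟨Φ, hΦ, hΦH⟩ := hH.exists_circle_lift
  exact (((circleCoeff n).restrictScalars ℝ).contDiff.comp_contDiffOn hΦ).congr fun z hz =>
    (circleCoeff_eq_taylorAt (hH.differentiable z hz) n (hΦH z hz)).symm

lemma dbarC_taylorAt (hH : SmoothEntireFamily H) (n : ℕ) {z : ℂ} (hz : 0 < z.im) {D : ℂ → ℂ}
    (hD : Differentiable ℂ D) (hHD : ∀ s, dbarC (fun w => H w s) z = D s) :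
    dbarC (fun w => taylorAt (H w) n) z = taylorAt D n := by
  obtain ⟨Φ, hΦ, hΦH⟩ := hH.exists_circle_lift
  have hΦz : DifferentiableAt ℝ Φ z :=
    (hΦ.contDiffAt (isOpen_im_pos.mem_nhds hz)).differentiableAt (by simp)
  have hcoeff : (fun w => taylorAt (H w) n) =ᶠ[𝓝 z] fun w => circleCoeff n (Φ w) :=
    (eventually_im_pos hz).mono fun w hw =>
      (circleCoeff_eq_taylorAt (hH.differentiable w hw) n (hΦH w hw)).symm
  rw [dbarC_congr hcoeff, dbarC_clm _ hΦz]
  refine circleCoeff_eq_taylorAt hD n fun ζ => ?_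
  have heval : (fun w => H w ζ) =ᶠ[𝓝 z] fun w => ContinuousMap.evalCLM ℂ ζ (Φ w) :=
    (eventually_im_pos hz).mono fun w hw => (hΦH w hw ζ).symm
  rw [← hHD, dbarC_congr heval, dbarC_clm _ hΦz, ContinuousMap.evalCLM_apply]

end SmoothEntireFamily

end Taylor

section Family

variable {K : Type*} [TopologicalSpace K]

/-- The Mellin kernels `mellinKernel a (σ κ)` as a curve in `C(K, ℂ)`. They are written with
exponentials so that the formula is continuous in `κ` for every real `t`. -/
def mellinKernelFamily (a : ℕ) (σ : C(K, ℂ)) (t : ℝ) : C(K, ℂ) where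
  toFun κ := Complex.exp ((σ κ - 1) * Real.log t) + Complex.exp ((a - σ κ) * Real.log t)
  continuous_toFun := by fun_prop

lemma mellinKernelFamily_apply (a : ℕ) (σ : C(K, ℂ)) {t : ℝ} (ht : 0 < t) (κ : K) :
    mellinKernelFamily a σ t κ = mellinKernel a (σ κ) t := by
  have ht0 : (t : ℂ) ≠ 0 := Complex.ofReal_ne_zero.2 ht.ne'
  rw [mellinKernel, Complex.cpow_def_of_ne_zero ht0, Complex.cpow_def_of_ne_zero ht0,
    ← Complex.ofReal_log ht.le, mul_comm _ (σ κ - 1), mul_comm _ ((a : ℂ) - σ κ)]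
  rfl

lemma continuousOn_mellinKernelFamily (a : ℕ) (σ : C(K, ℂ)) :
    ContinuousOn (mellinKernelFamily a σ) (Ioi 1) := by
  rw [continuousOn_iff_continuous_domRestrict]
  refine ContinuousMap.continuous_of_continuous_uncurry _ ?_
  have hlog : Continuous fun p : Ioi (1 : ℝ) × K => Real.log p.1 :=
    (continuous_subtype_val.comp continuous_fst).log fun p =>
      (one_pos.trans (mem_Ioi.1 p.1.2)).ne'
  change Continuous fun p : Ioi (1 : ℝ) × K =>
    Complex.exp ((σ p.2 - 1) * Real.log p.1) + Complex.exp ((a - σ p.2) * Real.log p.1)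
  fun_prop

lemma norm_exp_mul_log_le (w : ℂ) {t : ℝ} (ht : 1 < t) {n : ℕ} (hw : ‖w‖ ≤ n) :
    ‖Complex.exp (w * Real.log t)‖ ≤ t ^ n := by
  rw [Complex.norm_exp, Complex.re_mul_ofReal, mul_comm, Real.exp_mul,
    Real.exp_log (one_pos.trans ht), ← Real.rpow_natCast]
  exact Real.rpow_le_rpow_of_exponent_le ht.le ((Complex.re_le_norm w).trans hw)

variable [CompactSpace K]

lemma polyGrowth_mellinKernelFamily (a : ℕ) (σ : C(K, ℂ)) :
    PolyGrowth (mellinKernelFamily a σ) where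
  cont := continuousOn_mellinKernelFamily a σ
  bound := by
    set n := ⌈‖σ‖ + 1 + a⌉₊
    refine ⟨n, .of_bound 2 (eventually_principal.2 fun t ht => ?_)⟩
    have ht0 : 0 < t := one_pos.trans ht
    rw [ContinuousMap.norm_le _ (by positivity)]
    intro κ
    have hσ : ‖σ κ‖ ≤ ‖σ‖ := σ.norm_coe_le_norm κ
    have ha : (0 : ℝ) ≤ a := a.cast_nonneg
    have hceil : ‖σ‖ + 1 + a ≤ n := Nat.le_ceil _
    have hleft : ‖σ κ - 1‖ ≤ n := (norm_sub_le _ _).trans (by rw [norm_one]; linarith)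
    have hright : ‖a - σ κ‖ ≤ n := (norm_sub_le _ _).trans (by
      rw [Complex.norm_natCast]; linarith)
    rw [two_mul, Real.norm_of_nonneg (by positivity)]
    exact (norm_add_le _ _).trans
      (add_le_add (norm_exp_mul_log_le _ ht hleft) (norm_exp_mul_log_le _ ht hright))

lemma latSum_lap_mellinKernelFamily_apply (b c : ℕ) (σ : C(K, ℂ)) {z : ℂ} (hz : 0 < z.im) (κ : K) :
    latSum b c (lap (mellinKernelFamily (b + c) σ)) z κ = entirePart b c z (σ κ) := by
  have hW := polyGrowth_mellinKernelFamily (b + c) σ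
  have hsum := (ContinuousMap.evalCLM ℂ κ).hasSum ((rapidDecay_lap hW).hasSum_latTerm b c hz)
  refine hsum.tsum_eq.symm.trans (tsum_congr fun p => ?_)
  have hq := mul_pos Real.pi_pos (quad_pos p hz)
  have heval := (ContinuousMap.evalCLM ℂ κ).integral_comp_comm (hW.integrableOn hq)
  rw [latTerm, map_smul, lap, ← heval, latTerm, lap]
  congr 1
  refine setIntegral_congr_fun measurableSet_Ioi fun t ht => ?_
  simp only [ContinuousMap.evalCLM_apply, ContinuousMap.smul_apply]
  rw [mellinKernelFamily_apply _ _ (one_pos.trans ht)]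

end Family

section EisensteinTaylor

lemma smoothEntireFamily_eisNonpos {a : ℕ} (ha : Even a) :
    SmoothEntireFamily (eisNonpos a) where
  differentiable z hz := differentiable_eisNonpos ha hz
  exists_circle_lift := by
    let ι : C(Circle, ℂ) := ⟨(↑), by fun_prop⟩
    let P : C(Circle, ℂ) := ⟨fun ζ => ((ζ : ℂ) - a / 2) * (ζ - a / 2 - 1) *
      (1 / 2 * (Real.pi : ℂ) ^ ((a : ℂ) / 2)), by fun_prop⟩
    let Q : C(Circle, ℂ) := .const _ (1 / 2 * 0 ^ a)
    refine ⟨fun z => P * latSum a 0 (lap (mellinKernelFamily (a + 0) ι)) z + Q, ?_,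
      fun z hz ζ => ?_⟩
    · exact (contDiffOn_const.mul
        (contDiffOn_latSum_lap (polyGrowth_mellinKernelFamily _ _) a 0)).add contDiffOn_const
    · rw [ContinuousMap.add_apply, ContinuousMap.mul_apply,
        latSum_lap_mellinKernelFamily_apply _ _ _ hz, eisNonpos]
      simp only [P, Q, ContinuousMap.coe_mk, ContinuousMap.const_apply]
      rw [show ι ζ = ζ from rfl]
      ring

lemma smoothEntireFamily_eisPos {k : ℕ} (hk : Even k) : SmoothEntireFamily (eisPos k) where
  differentiable z hz := differentiable_eisPos hk hz
  exists_circle_lift := by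
    let σ : C(Circle, ℂ) := ⟨fun ζ => ζ + k, by fun_prop⟩
    let P : C(Circle, ℂ) := ⟨fun ζ => ((ζ : ℂ) + k / 2) * (ζ + k / 2 - 1) *
      (1 / 2 * (Real.pi : ℂ) ^ ((k : ℂ) / 2)), by fun_prop⟩
    refine ⟨fun z => ((z.im : ℂ) ^ k)⁻¹ • (P * latSum 0 k (lap (mellinKernelFamily (0 + k) σ)) z),
      ?_, fun z hz ζ => ?_⟩
    · have him : ContDiffOn ℝ ∞ (fun z : ℂ => ((z.im : ℂ) ^ k)⁻¹) {z : ℂ | 0 < z.im} :=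
        ((Complex.ofRealCLM.contDiff.comp Complex.imCLM.contDiff).contDiffOn.pow k).inv
          fun z hz => pow_ne_zero _ (Complex.ofReal_ne_zero.2 (ne_of_gt hz))
      exact him.smul (contDiffOn_const.mul
        (contDiffOn_latSum_lap (polyGrowth_mellinKernelFamily _ _) 0 k))
    · rw [ContinuousMap.smul_apply, ContinuousMap.mul_apply,
        latSum_lap_mellinKernelFamily_apply _ _ _ hz, eisPos]
      simp only [P, σ, ContinuousMap.coe_mk, smul_eq_mul]
      ring

/-- The sequence `0, b 0, b 1, …`, that is, the coefficients of `s` times the power series with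
coefficients `b`. -/
def shiftSeq (b : ℕ → ℂ) : ℕ → ℂ
  | 0 => 0
  | n + 1 => b n

lemma hasSum_shiftSeq {b : ℕ → ℂ} {s x : ℂ} (h : HasSum (fun n => b n * s ^ n) x) :
    HasSum (fun n => shiftSeq b n * s ^ n) (s * x) := by
  rw [← hasSum_nat_add_iff' 1, Finset.sum_range_one, shiftSeq, zero_mul, sub_zero]
  refine (h.mul_left s).congr_fun fun n => ?_
  rw [shiftSeq]
  ring

lemma differentiable_conj_neg_conj {f : ℂ → ℂ} (hf : Differentiable ℂ f) :
    Differentiable ℂ fun s => conj (f (-conj s)) := fun s => by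
  have h : DifferentiableAt ℂ (fun s => f (-s)) (conj s) := (hf _).comp _ differentiableAt_id.neg
  simpa only [Function.comp_def, Complex.conj_conj] using h.conj_conj

lemma hasSum_conj_neg_conj {f : ℂ → ℂ} (hf : Differentiable ℂ f) (s : ℂ) :
    HasSum (fun n => (-1) ^ n * conj (taylorAt f n) * s ^ n) (conj (f (-conj s))) := by
  refine ((hasSum_taylorAt hf (-conj s)).map (starRingEnd ℂ) Complex.continuous_conj).congr_fun
    fun n => ?_
  simp only [Function.comp_apply, map_mul, map_pow, map_neg, Complex.conj_conj, neg_pow s]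
  ring

lemma dbarC_taylorAt_eisNonpos {a : ℕ} (ha : Even a) (n : ℕ) {z : ℂ} (hz : 0 < z.im) :
    dbarC (fun w => taylorAt (eisNonpos a w) n) z =
      Complex.I / 2 * (z.im : ℂ) ^ a * ((-1) ^ n * conj (taylorAt (eisPos (a + 2) z) n)) := by
  have hd := differentiable_eisPos (ha.add even_two) hz
  have hD : Differentiable ℂ fun s =>
      Complex.I / 2 * (z.im : ℂ) ^ a * conj (eisPos (a + 2) z (-conj s)) :=
    (differentiable_conj_neg_conj hd).const_mul _
  rw [(smoothEntireFamily_eisNonpos ha).dbarC_taylorAt n hz hD fun s => dbarC_eisNonpos a s hz]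
  refine taylorAt_eq_of_hasSum hD (a := fun n =>
    Complex.I / 2 * (z.im : ℂ) ^ a * ((-1) ^ n * conj (taylorAt (eisPos (a + 2) z) n)))
    (fun s => ?_) n
  simpa only [mul_assoc] using (hasSum_conj_neg_conj hd s).mul_left
    (Complex.I / 2 * (z.im : ℂ) ^ a)

lemma dbarC_taylorAt_eisPos {a : ℕ} (ha : Even a) (n : ℕ) {z : ℂ} (hz : 0 < z.im) :
    dbarC (fun w => taylorAt (eisPos (a + 2) w) n) z =
      Complex.I / 2 * ((z.im : ℂ) ^ (a + 2))⁻¹ *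
        ((a + 1) * shiftSeq (fun m => (-1) ^ m * conj (taylorAt (eisNonpos a z) m)) n +
          shiftSeq (shiftSeq fun m => (-1) ^ m * conj (taylorAt (eisNonpos a z) m)) n) := by
  have hd := differentiable_eisNonpos ha hz
  have hD : Differentiable ℂ fun s => Complex.I / 2 * ((z.im : ℂ) ^ (a + 2))⁻¹ *
      (s * (s + (a + 1)) * conj (eisNonpos a z (-conj s))) :=
    ((differentiable_id.mul (differentiable_id.add_const _)).mul
      (differentiable_conj_neg_conj hd)).const_mul _
  rw [(smoothEntireFamily_eisPos (ha.add even_two)).dbarC_taylorAt n hz hD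
    fun s => dbarC_eisPos ha s hz]
  set b : ℕ → ℂ := fun m => (-1) ^ m * conj (taylorAt (eisNonpos a z) m)
  refine taylorAt_eq_of_hasSum hD (a := fun n => Complex.I / 2 * ((z.im : ℂ) ^ (a + 2))⁻¹ *
    ((a + 1) * shiftSeq b n + shiftSeq (shiftSeq b) n)) (fun s => ?_) n
  have hshift := hasSum_shiftSeq (b := b) (hasSum_conj_neg_conj hd s)
  have hsum := ((hshift.mul_left ((a : ℂ) + 1)).add (hasSum_shiftSeq hshift)).mul_left
    (Complex.I / 2 * ((z.im : ℂ) ^ (a + 2))⁻¹)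
  rw [← add_mul, add_comm _ s, ← mul_assoc (s + _), mul_comm _ s] at hsum
  exact hsum.congr_fun fun n => by ring

end EisensteinTaylor

open UpperHalfPlane

section Operators

lemma coe_ofComplex {w : ℂ} (hw : 0 < w.im) : (ofComplex w : ℂ) = w := by
  rw [ofComplex_apply_of_im_pos hw]

namespace IsSmooth

variable {f g : ℍ → ℂ}

lemma contDiffAt (hf : IsSmooth f) (z : ℍ) :
    ContDiffAt ℝ ∞ (fun w : ℂ => f (ofComplex w)) z :=
  ContDiffOn.contDiffAt hf (isOpen_im_pos.mem_nhds z.im_pos)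

lemma differentiableAt (hf : IsSmooth f) (z : ℍ) :
    DifferentiableAt ℝ (fun w : ℂ => f (ofComplex w)) z :=
  (hf.contDiffAt z).differentiableAt (by simp)

lemma const_mul (hf : IsSmooth f) (r : ℂ) : IsSmooth fun z => r * f z :=
  ContDiffOn.mul contDiffOn_const hf

lemma sum {ι : Type*} {s : Finset ι} {f : ι → ℍ → ℂ} (hf : ∀ i ∈ s, IsSmooth (f i)) :
    IsSmooth fun z => ∑ i ∈ s, f i z :=
  ContDiffOn.sum hf

lemma partialX_eq (hf : IsSmooth f) (z : ℍ) :
    partialX f z = fderiv ℝ (fun w : ℂ => f (ofComplex w)) z 1 :=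
  (hf.differentiableAt z).lineDeriv_eq_fderiv

lemma partialY_eq (hf : IsSmooth f) (z : ℍ) :
    partialY f z = fderiv ℝ (fun w : ℂ => f (ofComplex w)) z Complex.I :=
  (hf.differentiableAt z).lineDeriv_eq_fderiv

lemma dbar_eq (hf : IsSmooth f) (z : ℍ) : dbar f z = dbarC (fun w : ℂ => f (ofComplex w)) z := by
  rw [dbar, hf.partialX_eq, hf.partialY_eq, dbarC, smul_eq_mul, smul_eq_mul]

lemma xi_const_mul (hf : IsSmooth f) (k : ℤ) (r : ℂ) (z : ℍ) :
    xi k (fun w => r * f w) z = conj r * xi k f z := by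
  have h : dbarC (fun w : ℂ => r * f (ofComplex w)) z = r * _ :=
    dbarC_const_smul (hf.differentiableAt z) r
  rw [xi, xi, (hf.const_mul r).dbar_eq, hf.dbar_eq, h, map_mul]
  ring

lemma xi_sum {ι : Type*} {s : Finset ι} {f : ι → ℍ → ℂ} (hf : ∀ i ∈ s, IsSmooth (f i))
    (k : ℤ) (z : ℍ) : xi k (fun w => ∑ i ∈ s, f i w) z = ∑ i ∈ s, xi k (f i) z := by
  simp_rw [xi, ← Finset.mul_sum, ← map_sum]
  rw [(sum hf).dbar_eq, dbarC, fderiv_fun_sum fun i hi => (hf i hi).differentiableAt z,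
    Finset.sum_congr rfl fun i hi => (hf i hi).dbar_eq z]
  simp only [dbarC, sum_apply, Finset.smul_sum, Finset.sum_add_distrib,
    smul_add]

end IsSmooth

end Operators

section HyperbolicLaplacian

lemma hasLineDerivAt_im_zpow_mul_conj (k : ℤ) {u : ℂ → ℂ} {z v u' : ℂ} (hz : 0 < z.im)
    (hu : HasLineDerivAt ℝ u u' z v) :
    HasLineDerivAt ℝ (fun w => 2 * Complex.I * (w.im : ℂ) ^ k * conj (u w))
      (2 * Complex.I * (k * (z.im : ℂ) ^ (k - 1) * v.im) * conj (u z) +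
        2 * Complex.I * (z.im : ℂ) ^ k * conj u') z v := by
  have him : HasFDerivAt (fun w : ℂ => (w.im : ℂ)) (Complex.ofRealCLM ∘L Complex.imCLM) z :=
    (Complex.ofRealCLM ∘L Complex.imCLM).hasFDerivAt
  have hzpow := (hasDerivAt_zpow k (z.im : ℂ) (.inl (Complex.ofReal_ne_zero.2 hz.ne')))
  have hline : HasDerivAt (fun t : ℝ => ((z + t • v).im : ℂ) ^ k) _ 0 :=
    hzpow.comp_of_eq (0 : ℝ) (him.hasLineDerivAt v) (by simp)
  simpa [HasLineDerivAt] using! (hline.const_mul (2 * Complex.I)).mul (HasDerivAt.star hu)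

namespace IsSmooth

variable {f : ℍ → ℂ}

lemma hasLineDerivAt_fderiv (hf : IsSmooth f) (z : ℍ) (v u : ℂ) :
    HasLineDerivAt ℝ (fun w => fderiv ℝ (fun w : ℂ => f (ofComplex w)) w u)
      (fderiv ℝ (fderiv ℝ fun w : ℂ => f (ofComplex w)) z v u) z v := by
  have h := ((hf.contDiffAt z).fderiv_right (m := 1) (by norm_cast)).differentiableAt one_ne_zero
  exact ((ContinuousLinearMap.apply ℝ ℂ u).hasFDerivAt.comp (z : ℂ) h.hasFDerivAt).hasLineDerivAt v

lemma fderiv_fderiv_comm (hf : IsSmooth f) (z : ℍ) (v u : ℂ) :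
    fderiv ℝ (fderiv ℝ fun w : ℂ => f (ofComplex w)) z v u =
      fderiv ℝ (fderiv ℝ fun w : ℂ => f (ofComplex w)) z u v :=
  ((hf.contDiffAt z).isSymmSndFDerivAt (by simp; norm_cast)).eq v u

lemma hasLineDerivAt_partialX (hf : IsSmooth f) (z : ℍ) (v : ℂ) :
    HasLineDerivAt ℝ (fun w => partialX f (ofComplex w))
      (fderiv ℝ (fderiv ℝ fun w : ℂ => f (ofComplex w)) z v 1) z v :=
  (hf.hasLineDerivAt_fderiv z v 1).congr_of_eventuallyEq <|
    (eventually_im_pos z.im_pos).mono fun w hw => by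
      simp only [hf.partialX_eq, coe_ofComplex hw]

lemma hasLineDerivAt_partialY (hf : IsSmooth f) (z : ℍ) (v : ℂ) :
    HasLineDerivAt ℝ (fun w => partialY f (ofComplex w))
      (fderiv ℝ (fderiv ℝ fun w : ℂ => f (ofComplex w)) z v Complex.I) z v :=
  (hf.hasLineDerivAt_fderiv z v Complex.I).congr_of_eventuallyEq <|
    (eventually_im_pos z.im_pos).mono fun w hw => by
      simp only [hf.partialY_eq, coe_ofComplex hw]

lemma hasLineDerivAt_dbar (hf : IsSmooth f) (z : ℍ) (v : ℂ) :
    HasLineDerivAt ℝ (fun w => dbar f (ofComplex w))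
      (1 / 2 * (fderiv ℝ (fderiv ℝ fun w : ℂ => f (ofComplex w)) z v 1 +
        Complex.I * fderiv ℝ (fderiv ℝ fun w : ℂ => f (ofComplex w)) z v Complex.I)) z v :=
  HasDerivAt.const_mul _ ((hf.hasLineDerivAt_partialX z v).add
    (HasDerivAt.const_mul _ (hf.hasLineDerivAt_partialY z v)))

lemma lineDeriv_xi (hf : IsSmooth f) (k : ℤ) (z : ℍ) (v : ℂ) :
    lineDeriv ℝ (fun w => xi k f (ofComplex w)) z v =
      2 * Complex.I * (k * (z.im : ℂ) ^ (k - 1) * v.im) * conj (dbar f z) +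
        2 * Complex.I * (z.im : ℂ) ^ k *
          conj (1 / 2 * (fderiv ℝ (fderiv ℝ fun w : ℂ => f (ofComplex w)) z v 1 +
            Complex.I * fderiv ℝ (fderiv ℝ fun w : ℂ => f (ofComplex w)) z v Complex.I)) := by
  have h := hasLineDerivAt_im_zpow_mul_conj k z.im_pos (hf.hasLineDerivAt_dbar z v)
  rw [ofComplex_apply] at h
  refine (h.congr_of_eventuallyEq <| (eventually_im_pos z.im_pos).mono fun w hw => ?_).lineDeriv
  simp only [xi, ← UpperHalfPlane.coe_im, coe_ofComplex hw]

lemma hypLaplacian_eq_xi_xi (hf : IsSmooth f) (k : ℤ) (z : ℍ) :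
    hypLaplacian k f z = xi (2 - k) (xi k f) z := by
  set D := fderiv ℝ (fderiv ℝ fun w : ℂ => f (ofComplex w)) z with hD
  have hXX : partialX (partialX f) z = D 1 1 := (hf.hasLineDerivAt_partialX z 1).lineDeriv
  have hYY : partialY (partialY f) z = D Complex.I Complex.I :=
    (hf.hasLineDerivAt_partialY z Complex.I).lineDeriv
  have hYX : D 1 Complex.I = D Complex.I 1 := hf.fderiv_fderiv_comm z 1 Complex.I
  have hX_xi : partialX (xi k f) z =
      2 * Complex.I * z.im ^ k * conj (1 / 2 * (D 1 1 + Complex.I * D Complex.I 1)) := by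
    rw [partialX, hf.lineDeriv_xi, ← hD, hYX, Complex.one_im]
    simp only [Complex.ofReal_zero, mul_zero, zero_mul, zero_add]
  have hY_xi : partialY (xi k f) z = 2 * Complex.I * (k * z.im ^ (k - 1)) * conj (dbar f z) +
      2 * Complex.I * z.im ^ k *
        conj (1 / 2 * (D Complex.I 1 + Complex.I * D Complex.I Complex.I)) := by
    rw [partialY, hf.lineDeriv_xi, ← hD, Complex.I_im, Complex.ofReal_one, mul_one]
  rw [hypLaplacian, hXX, hYY, xi, dbar, hX_xi, hY_xi, dbar]
  simp only [map_mul, map_add, map_div₀, map_one, map_ofNat, Complex.conj_I,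
    map_neg, neg_neg, Complex.conj_conj, map_zpow₀, Complex.conj_ofReal, map_intCast]
  have hy : (z.im : ℂ) ≠ 0 := Complex.ofReal_ne_zero.2 z.im_ne_zero
  have hyk : (z.im : ℂ) ^ (2 - k) * z.im ^ k = z.im ^ 2 := by
    rw [← zpow_add₀ hy, sub_add_cancel]
    rfl
  have hyk' : (z.im : ℂ) ^ (2 - k) * z.im ^ (k - 1) = z.im := by
    rw [← zpow_add₀ hy, sub_add_sub_cancel, show (2 - 1 : ℤ) = 1 from rfl, zpow_one]
  linear_combination -(D 1 1 + D Complex.I Complex.I) * hyk +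
    Complex.I * k * (partialX f z + Complex.I * partialY f z) * hyk' +
    ((z.im : ℂ) ^ (2 - k) * z.im ^ k * (D 1 1 + D Complex.I Complex.I * (1 - Complex.I ^ 2)) -
      Complex.I * k * z.im ^ (2 - k) * z.im ^ (k - 1) *
        (partialX f z + Complex.I * partialY f z)) * Complex.I_sq

end IsSmooth

end HyperbolicLaplacian

section TaylorCoefficients

variable {a : ℕ}

lemma two_sub_weight (a : ℕ) : 2 - ((a + 2 : ℕ) : ℤ) = -(a : ℤ) := by
  push_cast
  ring

lemma weight_sub_one (a : ℕ) : (((a + 2 : ℕ) : ℤ) : ℂ) - 1 = a + 1 := by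
  push_cast
  ring

lemma G_ofComplex (ha : Even a) (n : ℕ) {w : ℂ} (hw : 0 < w.im) :
    G n ((a + 2 : ℕ) : ℤ) (ofComplex w) = taylorAt (eisPos (a + 2) w) n := by
  rw [G, taylorCoeff, (isEntireContinuation_eisPos (ha.add even_two) (by lia)
    _).doublyCompletedEis_eq, coe_ofComplex hw, taylorAt]

lemma F_ofComplex (ha : Even a) (n : ℕ) {w : ℂ} (hw : 0 < w.im) :
    F n (-(a : ℤ)) (ofComplex w) = taylorAt (eisNonpos a w) n := by
  rw [F, taylorCoeff, (isEntireContinuation_eisNonpos ha _).doublyCompletedEis_eq,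
    coe_ofComplex hw, taylorAt]

lemma isSmooth_G (ha : Even a) (n : ℕ) : IsSmooth (G n ((a + 2 : ℕ) : ℤ)) :=
  ((smoothEntireFamily_eisPos (ha.add even_two)).contDiffOn_taylorAt n).congr
    fun _ => G_ofComplex ha n

lemma isSmooth_F (ha : Even a) (n : ℕ) : IsSmooth (F n (-(a : ℤ))) :=
  ((smoothEntireFamily_eisNonpos ha).contDiffOn_taylorAt n).congr fun _ => F_ofComplex ha n

lemma xi_F (ha : Even a) (n : ℕ) (z : ℍ) :
    xi (-(a : ℤ)) (F n (-(a : ℤ))) z = (-1) ^ n * G n ((a + 2 : ℕ) : ℤ) z := by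
  have hy : (z.im : ℂ) ≠ 0 := Complex.ofReal_ne_zero.2 z.im_ne_zero
  have hG := G_ofComplex ha n z.im_pos
  have hF := (eventually_im_pos z.im_pos).mono fun _ => F_ofComplex ha n
  rw [ofComplex_apply] at hG
  rw [xi, (isSmooth_F ha n).dbar_eq, dbarC_congr hF, dbarC_taylorAt_eisNonpos ha n z.im_pos, hG,
    UpperHalfPlane.coe_im, zpow_neg, zpow_natCast]
  simp only [map_mul, map_div₀, map_pow, map_neg, map_one, map_ofNat, Complex.conj_I,
    Complex.conj_conj, Complex.conj_ofReal]
  field_simp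
  rw [Complex.I_sq]
  ring

lemma conj_shiftSeq (b : ℕ → ℂ) (n : ℕ) :
    conj (shiftSeq b n) = shiftSeq (fun m => conj (b m)) n := by
  cases n with
  | zero => exact map_zero _
  | succ n => rfl

lemma xi_G (ha : Even a) (n : ℕ) (z : ℍ) :
    xi ((a + 2 : ℕ) : ℤ) (G n ((a + 2 : ℕ) : ℤ)) z =
      (a + 1) * shiftSeq (fun m => (-1) ^ m * F m (-(a : ℤ)) z) n +
        shiftSeq (shiftSeq fun m => (-1) ^ m * F m (-(a : ℤ)) z) n := by
  have hy : (z.im : ℂ) ≠ 0 := Complex.ofReal_ne_zero.2 z.im_ne_zero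
  have hF (m : ℕ) : F m (-(a : ℤ)) z = taylorAt (eisNonpos a z) m := by
    rw [← F_ofComplex ha m z.im_pos, ofComplex_apply]
  have hG := (eventually_im_pos z.im_pos).mono fun _ => G_ofComplex ha n
  rw [xi, (isSmooth_G ha n).dbar_eq, dbarC_congr hG, dbarC_taylorAt_eisPos ha n z.im_pos,
    UpperHalfPlane.coe_im, zpow_natCast]
  simp only [map_mul, map_add, map_div₀, map_inv₀, map_pow, map_neg, map_one, map_ofNat,
    Complex.conj_I, conj_shiftSeq, Complex.conj_conj, Complex.conj_ofReal, map_natCast, hF]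
  field_simp
  rw [Complex.I_sq]
  ring

end TaylorCoefficients

section ConnectionEquations

lemma ConnectionEquations.mul_sub_eq {k : ℤ} (hk : k ≠ 1) {c : ℕ → ℤ → ℂ}
    (hc : ConnectionEquations k c) {n l : ℕ} (hl : l ≤ n + 1) :
    ((k : ℂ) - 1) * c (n + 1) l - c (n + 1) (l - 1) = (k - 1) * c n l := by
  have hk1 : (k : ℂ) - 1 ≠ 0 := sub_ne_zero.2 (mod_cast hk)
  rw [hc.rec_eq (n + 1) n.succ_pos l (Int.natCast_nonneg l) (mod_cast hl), Nat.add_sub_cancel]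
  field_simp
  ring

lemma ConnectionEquations.shiftSeq_eq {k : ℤ} {c : ℕ → ℤ → ℂ} (hc : ConnectionEquations k c)
    (n l : ℕ) : shiftSeq (fun l => (-1) ^ l * conj (c n l)) l =
      -((-1) ^ l * conj (c n (l - 1))) := by
  cases l with
  | zero => rw [shiftSeq, Nat.cast_zero, zero_sub, hc.neg_one, map_zero, mul_zero, neg_zero]
  | succ l => rw [shiftSeq, pow_succ, Nat.cast_succ, add_sub_cancel_right]; ring

lemma sum_mul_shiftSeq (u b : ℕ → ℂ) (m : ℕ) :
    ∑ l ∈ Finset.range (m + 2), u l * shiftSeq b (m + 1 - l) =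
      ∑ l ∈ Finset.range (m + 1), u l * b (m - l) := by
  rw [Finset.sum_range_succ, Nat.sub_self, shiftSeq, mul_zero, add_zero]
  refine Finset.sum_congr rfl fun l hl => ?_
  rw [Nat.sub_add_comm (Nat.lt_succ_iff.1 (Finset.mem_range.1 hl)), shiftSeq]

lemma sum_mul_shiftSeq_eq_sum_shiftSeq_mul (u b : ℕ → ℂ) (m : ℕ) :
    ∑ l ∈ Finset.range (m + 1), u l * shiftSeq b (m - l) =
      ∑ l ∈ Finset.range (m + 1), shiftSeq u l * b (m - l) := by
  cases m with
  | zero => simp [shiftSeq]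
  | succ m =>
    rw [sum_mul_shiftSeq, Finset.sum_range_succ' _ (m + 1)]
    simp [shiftSeq]

/- In terms of generating series `U = ∑ u l s^l` and `B = ∑ b l s^l` the left side is a coefficient
of `((k - 1) s + s²) U B`, and the connection equations say that `(k - 1 + s) U`, with `U` taken
from row `n + 1`, agrees up to degree `n` with `k - 1` times the series of row `n`. -/
lemma ConnectionEquations.sum_eq {k : ℤ} (hk : k ≠ 1) {c : ℕ → ℤ → ℂ}
    (hc : ConnectionEquations k c) (b : ℕ → ℂ) (n : ℕ) :
    ∑ l ∈ Finset.range (n + 2), (-1) ^ l * conj (c (n + 1) l) *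
        ((k - 1) * shiftSeq b (n + 1 - l) + shiftSeq (shiftSeq b) (n + 1 - l)) =
      (k - 1) * ∑ l ∈ Finset.range (n + 1), (-1) ^ l * conj (c n l) * b (n - l) := by
  simp_rw [mul_add, mul_left_comm _ ((k : ℂ) - 1)]
  rw [Finset.sum_add_distrib, ← Finset.mul_sum, sum_mul_shiftSeq, sum_mul_shiftSeq,
    sum_mul_shiftSeq_eq_sum_shiftSeq_mul, Finset.mul_sum, Finset.mul_sum,
    ← Finset.sum_add_distrib]
  refine Finset.sum_congr rfl fun l hl => ?_
  have hrec := congrArg (starRingEnd ℂ) (hc.mul_sub_eq hk (Finset.mem_range.1 hl).le)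
  simp only [map_sub, map_mul, map_one, map_intCast] at hrec
  rw [hc.shiftSeq_eq]
  linear_combination (-1) ^ l * b (n - l) * hrec

/-- Constants solving the connection equations with prescribed values at `ℓ = n + 1`. -/
def connectionConstants (r : ℂ) (d : ℕ → ℂ) : ℕ → ℕ → ℂ
  | _, 0 => 1
  | 0, _ + 1 => d 0
  | n + 1, l + 1 =>
    if l = n + 1 then d (n + 1)
    else r * connectionConstants r d (n + 1) l + connectionConstants r d n (l + 1)

lemma connectionConstants_self_add_one (r : ℂ) (d : ℕ → ℂ) (n : ℕ) :
    connectionConstants r d n (n + 1) = d n := by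
  cases n with
  | zero => rw [connectionConstants]
  | succ n => rw [connectionConstants, if_pos rfl]

lemma exists_connectionEquations (k : ℤ) (d : ℕ → ℂ) :
    ∃ c : ℕ → ℤ → ℂ, ConnectionEquations k c ∧ ∀ n : ℕ, c n ((n : ℤ) + 1) = d n := by
  set C := connectionConstants (1 / ((k : ℂ) - 1)) d with hC
  have C_zero (n : ℕ) : C n 0 = 1 := by cases n <;> rw [hC, connectionConstants]
  let c (n : ℕ) : ℤ → ℂ
    | .ofNat l => C n l
    | .negSucc _ => 0
  refine ⟨c, ⟨C_zero, fun n => rfl, fun n hn l hl hln => ?_⟩,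
    connectionConstants_self_add_one _ d⟩
  obtain ⟨n, rfl⟩ := Nat.exists_eq_add_of_le' hn
  obtain ⟨l, rfl⟩ := Int.eq_ofNat_of_zero_le hl
  cases l with
  | zero =>
    change C (n + 1) 0 = 1 / ((k : ℂ) - 1) * 0 + C n 0
    rw [C_zero, C_zero, mul_zero, zero_add]
  | succ l =>
    rw [Nat.cast_succ, add_sub_cancel_right]
    change C (n + 1) (l + 1) = 1 / ((k : ℂ) - 1) * C (n + 1) l + C n (l + 1)
    rw [hC, connectionConstants, if_neg (by lia)]

end ConnectionEquations

section RampAndTower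

lemma add_sum_Icc_one_eq_sum_range (n : ℕ) (u : ℕ → ℂ) :
    u 0 + ∑ l ∈ Finset.Icc 1 n, u l = ∑ l ∈ Finset.range (n + 1), u l := by
  rw [Finset.range_eq_Ico, Finset.sum_eq_sum_Ico_succ_bot n.succ_pos]
  rfl

variable {c : ℕ → ℤ → ℂ}

lemma modG_eq_sum {k : ℤ} {n : ℕ} (hc : c n 0 = 1) :
    modG k c n = fun z => ∑ l ∈ Finset.range (n + 1), ((-1) ^ l * c n l) * G (n - l) k z := by
  ext z
  rw [← add_sum_Icc_one_eq_sum_range, modG, pow_zero, Nat.cast_zero, hc, one_mul, one_mul,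
    Nat.sub_zero]

lemma modF_eq_sum {k : ℤ} {n : ℕ} (hc : c n 0 = 1) :
    modF k c n =
      fun z => ∑ l ∈ Finset.range (n + 1), ((-1) ^ n * conj (c n l)) * F (n - l) (2 - k) z := by
  ext z
  simp_rw [mul_assoc, ← Finset.mul_sum]
  rw [← add_sum_Icc_one_eq_sum_range, modF, Nat.cast_zero, hc, map_one, one_mul, Nat.sub_zero]

variable {a : ℕ}

lemma isSmooth_modG (ha : Even a) {n : ℕ} (hc : c n 0 = 1) :
    IsSmooth (modG ((a + 2 : ℕ) : ℤ) c n) := by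
  rw [modG_eq_sum hc]
  exact IsSmooth.sum fun l _ => (isSmooth_G ha _).const_mul _

lemma isSmooth_modF (ha : Even a) {n : ℕ} (hc : c n 0 = 1) :
    IsSmooth (modF ((a + 2 : ℕ) : ℤ) c n) := by
  rw [modF_eq_sum hc, two_sub_weight]
  exact IsSmooth.sum fun l _ => (isSmooth_F ha _).const_mul _

lemma neg_one_pow_mul_neg_one_pow_sub {n l : ℕ} (h : l ≤ n) :
    (-1 : ℂ) ^ n * (-1) ^ (n - l) = (-1) ^ l := by
  rw [← Nat.sub_add_cancel h, Nat.add_sub_cancel, pow_add, mul_right_comm, ← mul_pow, neg_one_mul,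
    neg_neg, one_pow, one_mul]

lemma xi_modF (ha : Even a) {n : ℕ} (hc : c n 0 = 1) (z : ℍ) :
    xi (2 - ((a + 2 : ℕ) : ℤ)) (modF ((a + 2 : ℕ) : ℤ) c n) z = modG ((a + 2 : ℕ) : ℤ) c n z := by
  rw [modF_eq_sum hc, modG_eq_sum hc, two_sub_weight,
    IsSmooth.xi_sum fun l _ => (isSmooth_F ha (n - l)).const_mul _]
  refine Finset.sum_congr rfl fun l hl => ?_
  rw [(isSmooth_F ha _).xi_const_mul, xi_F ha,
    ← neg_one_pow_mul_neg_one_pow_sub (Nat.lt_succ_iff.1 (Finset.mem_range.1 hl))]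
  simp only [map_mul, map_pow, map_neg, map_one, Complex.conj_conj]
  ring

lemma xi_modG (ha : Even a) (hc : ConnectionEquations ((a + 2 : ℕ) : ℤ) c) (n : ℕ) (z : ℍ) :
    xi ((a + 2 : ℕ) : ℤ) (modG ((a + 2 : ℕ) : ℤ) c (n + 1)) z =
      (((a + 2 : ℕ) : ℤ) - 1 : ℂ) * modF ((a + 2 : ℕ) : ℤ) c n z := by
  have hterm (l : ℕ) : xi ((a + 2 : ℕ) : ℤ)
      (fun w => (-1) ^ l * c (n + 1) l * G (n + 1 - l) ((a + 2 : ℕ) : ℤ) w) z = _ :=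
    ((isSmooth_G ha _).xi_const_mul _ _ z).trans (congrArg _ (xi_G ha (n + 1 - l) z))
  rw [modG_eq_sum (hc.zero _), modF_eq_sum (hc.zero _), two_sub_weight,
    IsSmooth.xi_sum fun l _ => (isSmooth_G ha _).const_mul _,
    Finset.sum_congr rfl fun l _ => hterm l]
  simp only [map_mul, map_pow, map_neg, map_one, ← weight_sub_one]
  rw [hc.sum_eq (by lia)]
  congr 1
  refine Finset.sum_congr rfl fun l hl => ?_
  have hsq : (-1 : ℂ) ^ (n - l) * (-1) ^ (n - l) = 1 := by
    rw [← mul_pow, neg_one_mul, neg_neg, one_pow]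
  rw [← neg_one_pow_mul_neg_one_pow_sub (Nat.lt_succ_iff.1 (Finset.mem_range.1 hl))]
  linear_combination (-1) ^ n * conj (c n l) * F (n - l) (-(a : ℤ)) z * hsq

lemma hypLaplacian_modG (ha : Even a) (hc : ConnectionEquations ((a + 2 : ℕ) : ℤ) c) (n : ℕ)
    (z : ℍ) : hypLaplacian ((a + 2 : ℕ) : ℤ) (modG ((a + 2 : ℕ) : ℤ) c (n + 1)) z =
      (((a + 2 : ℕ) : ℤ) - 1 : ℂ) * modG ((a + 2 : ℕ) : ℤ) c n z := by
  rw [(isSmooth_modG ha (hc.zero _)).hypLaplacian_eq_xi_xi, funext (xi_modG ha hc n),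
    (isSmooth_modF ha (hc.zero n)).xi_const_mul, xi_modF ha (hc.zero n), map_sub, map_intCast,
    map_one]

lemma hypLaplacian_modF (ha : Even a) (hc : ConnectionEquations ((a + 2 : ℕ) : ℤ) c) (n : ℕ)
    (z : ℍ) : hypLaplacian (2 - ((a + 2 : ℕ) : ℤ)) (modF ((a + 2 : ℕ) : ℤ) c (n + 1)) z =
      (((a + 2 : ℕ) : ℤ) - 1 : ℂ) * modF ((a + 2 : ℕ) : ℤ) c n z := by
  rw [(isSmooth_modF ha (hc.zero _)).hypLaplacian_eq_xi_xi,
    funext (xi_modF ha (hc.zero (n + 1))), sub_sub_cancel, xi_modG ha hc]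

end RampAndTower

end PolyMaass

end

theorem mainTheorem9 (k : ℤ) (hk_even : Even k) (hk : 2 ≤ k) :
    -- the doubly completed Eisenstein series of weights `k` and `2 - k` are well defined
    -- as entire functions of `s`
    (∀ z : UpperHalfPlane,
      PolyMaass.IsEntireContinuation k z (PolyMaass.doublyCompletedEis k z) ∧
      PolyMaass.IsEntireContinuation (2 - k) z (PolyMaass.doublyCompletedEis (2 - k) z)) ∧
    (∀ c : ℕ → ℤ → ℂ, PolyMaass.ConnectionEquations k c →
      (∀ n : ℕ, PolyMaass.IsSmooth (PolyMaass.modG k c n) ∧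
        PolyMaass.IsSmooth (PolyMaass.modF k c n)) ∧
      -- ramp relations
      (∀ n : ℕ, 1 ≤ n → ∀ z : UpperHalfPlane,
        PolyMaass.xi k (PolyMaass.modG k c n) z
          = ((k : ℂ) - 1) * PolyMaass.modF k c (n - 1) z) ∧
      (∀ n : ℕ, 1 ≤ n → ∀ z : UpperHalfPlane,
        PolyMaass.xi (2 - k) (PolyMaass.modF k c n) z = PolyMaass.modG k c n z) ∧
      -- tower relations
      (∀ n : ℕ, 1 ≤ n → ∀ z : UpperHalfPlane,
        PolyMaass.hypLaplacian k (PolyMaass.modG k c n) z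
          = ((k : ℂ) - 1) * PolyMaass.modG k c (n - 1) z) ∧
      (∀ n : ℕ, 1 ≤ n → ∀ z : UpperHalfPlane,
        PolyMaass.hypLaplacian (2 - k) (PolyMaass.modF k c n) z
          = ((k : ℂ) - 1) * PolyMaass.modF k c (n - 1) z)) ∧
    -- the constants `c_{n,k,n+1}` are free
    (∀ d : ℕ → ℂ, ∃ c : ℕ → ℤ → ℂ, PolyMaass.ConnectionEquations k c ∧
      ∀ n : ℕ, c n ((n : ℤ) + 1) = d n) := by
  obtain ⟨a, rfl⟩ : ∃ a : ℕ, k = ((a + 2 : ℕ) : ℤ) := ⟨(k - 2).toNat, by lia⟩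
  have ha : Even a := by
    rwa [Int.even_coe_nat, Nat.even_add, iff_true_right even_two] at hk_even
  refine ⟨fun z => ⟨?_, ?_⟩, fun c hc => ⟨fun n => ⟨PolyMaass.isSmooth_modG ha (hc.zero n),
    PolyMaass.isSmooth_modF ha (hc.zero n)⟩, ?_,
    fun n _ z => PolyMaass.xi_modF ha (hc.zero n) z, ?_, ?_⟩,
    PolyMaass.exists_connectionEquations _⟩
  · have hG := PolyMaass.isEntireContinuation_eisPos (ha.add even_two) (by lia) z
    exact hG.doublyCompletedEis_eq.symm ▸ hG
  · have hF := PolyMaass.isEntireContinuation_eisNonpos ha z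
    rw [PolyMaass.two_sub_weight]
    exact hF.doublyCompletedEis_eq.symm ▸ hF
  all_goals
    intro n hn z
    obtain ⟨m, rfl⟩ := Nat.exists_eq_add_of_le' hn
  · exact PolyMaass.xi_modG ha hc m z
  · exact PolyMaass.hypLaplacian_modG ha hc m z
  · exact PolyMaass.hypLaplacian_modF ha hc m z
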